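/- Let $M\subset\mathbb{C}^3$ be a real-analytic real hypersurface (of real dimension $5$). For $p\in M$ let $\mathfrak{hol}(M,p)$ be the real Lie algebra of germs at $p$ of holomorphic vector fields $X=\sum_{k=1}^{3}a_k(z)\,\partial_{z_k}$ such that $X+\overline X$ is tangent to $M$ at all points of $M$ near $p$. Suppose that $M$ is (i) holomorphically simply-transitive: for every $p\in M$ the evaluation map $\mathfrak{hol}(M,p)\to T_pM$, $X\mapsto (X+\overline X)|_p$, is surjective, and $\dim_{\mathbb R}\mathfrak{hol}(M,p)=5=\dim M$; and (ii) Levi non-degenerate at every point. Let $p\in M$ be such that the Lie algebra $\mathfrak{hol}(M,p)$ contains a $3$-dimensional abelian ideal. Then, near $p$, $M$ is a tube on an affinely simply-transitive base: there are a connected real-analytic surface $\mathcal S\subset\mathbb R^3$ and a biholomorphism $\varphi:U\to V$ between open subsets of $\mathbb{C}^3$ with $p\in U$ and $\varphi(M\cap U)=M_{\mathcal S}\cap V$, where $M_{\mathcal S}=\{z\in\mathbb C^3:\operatorname{Re}z\in\mathcal S\}$, such that $\mathcal S$ is affinely simply-transitive. The latter means that, for the space $\mathfrak{aff}(\mathcal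 S)$ of real affine vector fields $\sum_k\big(\sum_\ell A_{k\ell}x_\ell+b_k\big)\partial_{x_k}$ on $\mathbb R^3$ that are everywhere tangent to $\mathcal S$, the evaluation map $\mathfrak{aff}(\mathcal S)\to T_x\mathcal S$ is surjective for every $x\in\mathcal S$, and $\dim_{\mathbb R}\mathfrak{aff}(\mathcal S)=2=\dim\mathcal S$. -/

import Mathlib

open Filter Topology

/-- Real-analytic function germ `r` at `p` defining the set `M` near `p`, with nonzero
differential at `p`. -/
def IsLocalDefiningFunction {E : Type*} [NormedAddCommGroup E] [NormedSpace ℝ E]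
    (M : Set E) (p : E) (r : E → ℝ) : Prop :=
  AnalyticAt ℝ r p ∧ fderiv ℝ r p ≠ 0 ∧ ∀ᶠ q in 𝓝 p, (q ∈ M ↔ r q = 0)

/-- `M` is an (embedded, not necessarily closed) real-analytic real hypersurface of `E`. -/
def IsAnalyticHypersurface {E : Type*} [NormedAddCommGroup E] [NormedSpace ℝ E]
    (M : Set E) : Prop :=
  ∀ p ∈ M, ∃ r : E → ℝ, IsLocalDefiningFunction M p r

/-- The tangent space at `q` of a real-analytic submanifold `M`: the vectors killed by the
differentials of all analytic function germs at `q` that vanish on `M`. For a hypersurface with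
local defining function `r` this is the kernel of `dr` at `q`. -/
def tangentSpaceAt {E : Type*} [NormedAddCommGroup E] [NormedSpace ℝ E]
    (M : Set E) (q : E) : Submodule ℝ E where
  carrier := {v | ∀ f : E → ℝ, AnalyticAt ℝ f q → (∀ᶠ x in 𝓝 q, x ∈ M → f x = 0) →
    fderiv ℝ f q v = 0}
  add_mem' := fun hv hw f hf h0 => by rw [map_add, hv f hf h0, hw f hf h0, add_zero]
  zero_mem' := fun f _ _ => map_zero _
  smul_mem' := fun c v hv f hf h0 => by rw [map_smul, hv f hf h0, smul_zero]

/-- The hypersurface `M ⊂ ℂ³` is Levi non-degenerate at `p`: for a defining function `r` with real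
Hessian `B` at `p`, the form `B(v,w) + B(iv,iw)` (which is `4 Re ∑ r_{z_j z̄_k} v_j w̄_k`) is
non-degenerate on the complex tangent space `T_pM ∩ i T_pM`. A Hermitian form is non-degenerate if
and only if its real part is, and the condition does not depend on the choice of `r`. -/
def IsLeviNondegenerateAt (M : Set (Fin 3 → ℂ)) (p : Fin 3 → ℂ) : Prop :=
  ∃ r : (Fin 3 → ℂ) → ℝ, IsLocalDefiningFunction M p r ∧
    ∀ v : Fin 3 → ℂ, fderiv ℝ r p v = 0 → fderiv ℝ r p (Complex.I • v) = 0 →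
      (∀ w : Fin 3 → ℂ, fderiv ℝ r p w = 0 → fderiv ℝ r p (Complex.I • w) = 0 →
        fderiv ℝ (fderiv ℝ r) p v w
          + fderiv ℝ (fderiv ℝ r) p (Complex.I • v) (Complex.I • w) = 0) →
      v = 0

/-- The real vector space of germs at `p` of holomorphic vector fields
`X = ∑ a_k(z) ∂/∂z_k` on `ℂ³`, where `X` is given by its coefficient vector `(a_1, a_2, a_3)`. -/
def HolVectorField (p : Fin 3 → ℂ) : Submodule ℝ (Germ (𝓝 p) (Fin 3 → ℂ)) where
  carrier := {g | ∃ X : (Fin 3 → ℂ) → (Fin 3 → ℂ), AnalyticAt ℂ X p ∧ (X : Germ (𝓝 p) _) = g}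
  add_mem' := by
    rintro _ _ ⟨X, hX, rfl⟩ ⟨Y, hY, rfl⟩
    exact ⟨X + Y, hX.add hY, rfl⟩
  zero_mem' := ⟨0, analyticAt_const, rfl⟩
  smul_mem' := by
    rintro c _ ⟨X, hX, rfl⟩
    exact ⟨c • X, hX.const_smul, rfl⟩

namespace HolVectorField

open VectorField

variable {p : Fin 3 → ℂ}

/-- The Lie bracket of vector fields, on germs. -/
noncomputable def germBracket (g h : Germ (𝓝 p) (Fin 3 → ℂ)) : Germ (𝓝 p) (Fin 3 → ℂ) :=
  Quotient.map₂ (fun X Y => lieBracket ℂ X Y)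
    (fun _ _ hX _ _ hY => Filter.EventuallyEq.lieBracket_vectorField hX hY) g h

theorem germBracket_coe (X Y : (Fin 3 → ℂ) → (Fin 3 → ℂ)) :
    germBracket (X : Germ (𝓝 p) (Fin 3 → ℂ)) (Y : Germ (𝓝 p) (Fin 3 → ℂ))
      = ((lieBracket ℂ X Y : (Fin 3 → ℂ) → (Fin 3 → ℂ)) : Germ (𝓝 p) (Fin 3 → ℂ)) := rfl

theorem analyticAt_lieBracket {X Y : (Fin 3 → ℂ) → (Fin 3 → ℂ)}
    (hX : AnalyticAt ℂ X p) (hY : AnalyticAt ℂ Y p) : AnalyticAt ℂ (lieBracket ℂ X Y) p := by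
  have h : ContDiffAt ℂ ⊤ (lieBracket ℂ X Y) p :=
    ContDiffAt.lieBracket_vectorField (n := ⊤) hX.contDiffAt hY.contDiffAt le_rfl
  exact h.analyticAt

noncomputable instance : Bracket (HolVectorField p) (HolVectorField p) where
  bracket g h := ⟨germBracket g.1 h.1, by
    obtain ⟨_, X, hX, rfl⟩ := g
    obtain ⟨_, Y, hY, rfl⟩ := h
    exact ⟨lieBracket ℂ X Y, analyticAt_lieBracket hX hY, rfl⟩⟩

theorem coe_bracket (g h : HolVectorField p) :
    ((⁅g, h⁆ : HolVectorField p) : Germ (𝓝 p) (Fin 3 → ℂ)) = germBracket g.1 h.1 := rfl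

theorem eventually_differentiableAt {X : (Fin 3 → ℂ) → (Fin 3 → ℂ)} (hX : AnalyticAt ℂ X p) :
    ∀ᶠ q in 𝓝 p, DifferentiableAt ℂ X q :=
  hX.eventually_analyticAt.mono fun _ h => h.differentiableAt

noncomputable instance : LieRing (HolVectorField p) where
  add_lie := by
    rintro ⟨_, X, hX, rfl⟩ ⟨_, Y, hY, rfl⟩ ⟨_, Z, hZ, rfl⟩
    refine Subtype.ext (Germ.coe_eq.2 ?_)
    filter_upwards [eventually_differentiableAt hX, eventually_differentiableAt hY] with q h1 h2
    exact lieBracket_add_left h1 h2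
  lie_add := by
    rintro ⟨_, X, hX, rfl⟩ ⟨_, Y, hY, rfl⟩ ⟨_, Z, hZ, rfl⟩
    refine Subtype.ext (Germ.coe_eq.2 ?_)
    filter_upwards [eventually_differentiableAt hY, eventually_differentiableAt hZ] with q h1 h2
    exact lieBracket_add_right h1 h2
  lie_self := by
    rintro ⟨_, X, hX, rfl⟩
    refine Subtype.ext (Germ.coe_eq.2 ?_)
    filter_upwards with q
    rw [lieBracket_self]
    rfl
  leibniz_lie := by
    rintro ⟨_, X, hX, rfl⟩ ⟨_, Y, hY, rfl⟩ ⟨_, Z, hZ, rfl⟩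
    refine Subtype.ext (Germ.coe_eq.2 ?_)
    filter_upwards [hX.eventually_analyticAt, hY.eventually_analyticAt,
      hZ.eventually_analyticAt] with q h1 h2 h3
    exact leibniz_identity_lieBracket (n := minSmoothness ℂ 2) le_rfl
      h1.contDiffAt h2.contDiffAt h3.contDiffAt

noncomputable instance : LieAlgebra ℝ (HolVectorField p) where
  lie_smul := by
    rintro c ⟨_, X, hX, rfl⟩ ⟨_, Y, hY, rfl⟩
    refine Subtype.ext (Germ.coe_eq.2 ?_)
    filter_upwards [eventually_differentiableAt hY] with q h1
    exact lieBracket_const_smul_right (c := (c : ℂ)) h1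

theorem lieBracket_complex_eq_real {X Y : (Fin 3 → ℂ) → (Fin 3 → ℂ)} {q : Fin 3 → ℂ}
    (hX : DifferentiableAt ℂ X q) (hY : DifferentiableAt ℂ Y q) :
    lieBracket ℂ X Y q = lieBracket ℝ X Y q := by
  simp only [lieBracket_eq]
  rw [hX.fderiv_restrictScalars ℝ, hY.fderiv_restrictScalars ℝ]
  rfl

end HolVectorField

/-- A holomorphic vector field `X` on `ℂ³`, seen as the real vector field `X + X̄` with value
`X(q) ∈ ℂ³ = ℝ⁶` at `q`, is tangent to `M` along `M` near `p`. -/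
def IsTangentNear (M : Set (Fin 3 → ℂ)) (p : Fin 3 → ℂ)
    (X : (Fin 3 → ℂ) → (Fin 3 → ℂ)) : Prop :=
  ∀ᶠ q in 𝓝 p, q ∈ M → X q ∈ tangentSpaceAt M q

theorem IsTangentNear.lieBracket {M : Set (Fin 3 → ℂ)} {p : Fin 3 → ℂ}
    {X Y : (Fin 3 → ℂ) → (Fin 3 → ℂ)} (hXa : AnalyticAt ℂ X p) (hYa : AnalyticAt ℂ Y p)
    (hX : IsTangentNear M p X) (hY : IsTangentNear M p Y) :
    IsTangentNear M p (VectorField.lieBracket ℂ X Y) := by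
  filter_upwards [hX.eventually_nhds, hY.eventually_nhds, hXa.eventually_analyticAt,
    hYa.eventually_analyticAt] with q hXq hYq hXaq hYaq hq f hf h0
  have hf0 : ∀ {Z : (Fin 3 → ℂ) → (Fin 3 → ℂ)},
      (∀ᶠ y in 𝓝 q, y ∈ M → Z y ∈ tangentSpaceAt M y) →
      ∀ᶠ y in 𝓝 q, y ∈ M → fderiv ℝ f y (Z y) = 0 := by
    intro Z hZ
    filter_upwards [hZ, hf.eventually_analyticAt, h0.eventually_nhds] with y hZy hfy h0y hy
    exact hZy hy f hfy h0y
  have han : ∀ {Z : (Fin 3 → ℂ) → (Fin 3 → ℂ)}, AnalyticAt ℂ Z q →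
      AnalyticAt ℝ (fun y => fderiv ℝ f y (Z y)) q := by
    intro Z hZ
    have h : ContDiffAt ℝ ⊤ (fun y => fderiv ℝ f y (Z y)) q :=
      ContDiffAt.clm_apply hf.fderiv.contDiffAt (AnalyticAt.restrictScalars hZ).contDiffAt
    exact h.analyticAt
  rw [HolVectorField.lieBracket_complex_eq_real hXaq.differentiableAt hYaq.differentiableAt,
    VectorField.fderiv_apply_lieBracket (n := minSmoothness ℝ 2) hf.contDiffAt le_rfl
      hYaq.restrictScalars.differentiableAt hXaq.restrictScalars.differentiableAt,
    hXq.self_of_nhds hq _ (han hYaq) (hf0 hYq), hYq.self_of_nhds hq _ (han hXaq) (hf0 hXq),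
    sub_zero]

/-- The real Lie algebra `𝔥𝔬𝔩(M)` of infinitesimal holomorphic symmetries of `M` at `p`: germs at
`p` of holomorphic vector fields `X` on `ℂ³` such that `X + X̄` is tangent to `M` along `M`. -/
noncomputable def hol (M : Set (Fin 3 → ℂ)) (p : Fin 3 → ℂ) :
    LieSubalgebra ℝ (HolVectorField p) where
  carrier := {g | ∃ X : (Fin 3 → ℂ) → (Fin 3 → ℂ), AnalyticAt ℂ X p ∧ IsTangentNear M p X ∧
    (X : Germ (𝓝 p) _) = g.1}
  add_mem' := by
    rintro ⟨_, _⟩ ⟨_, _⟩ ⟨X, hXa, hX, rfl⟩ ⟨Y, hYa, hY, rfl⟩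
    refine ⟨X + Y, hXa.add hYa, ?_, rfl⟩
    filter_upwards [hX, hY] with q h1 h2 hq
    exact add_mem (h1 hq) (h2 hq)
  zero_mem' := ⟨0, analyticAt_const, Eventually.of_forall fun _ _ => zero_mem _, rfl⟩
  smul_mem' := by
    rintro c ⟨_, _⟩ ⟨X, hXa, hX, rfl⟩
    refine ⟨c • X, hXa.const_smul, ?_, rfl⟩
    filter_upwards [hX] with q h1 hq
    exact Submodule.smul_mem _ c (h1 hq)
  lie_mem' := by
    rintro ⟨_, _⟩ ⟨_, _⟩ ⟨X, hXa, hX, rfl⟩ ⟨Y, hYa, hY, rfl⟩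
    exact ⟨VectorField.lieBracket ℂ X Y, HolVectorField.analyticAt_lieBracket hXa hYa,
      hX.lieBracket hXa hYa hY, rfl⟩

/-- `M⁵ ⊂ ℂ³` is (locally) holomorphically simply-transitive: at every `p ∈ M` the evaluation
`𝔥𝔬𝔩(M) → T_pM` is onto, and `dim 𝔥𝔬𝔩(M) = 5 = dim M`. -/
def IsHolSimplyTransitive (M : Set (Fin 3 → ℂ)) : Prop :=
  ∀ p ∈ M, (∀ v ∈ tangentSpaceAt M p, ∃ X ∈ hol M p, X.1.value = v) ∧
    Module.finrank ℝ (hol M p) = 5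

/-- The affine symmetry algebra of `S ⊂ ℝ³`: affine vector fields `x ↦ A x + b` that are everywhere
tangent to `S`. -/
def affSymmetries (S : Set (Fin 3 → ℝ)) : Submodule ℝ ((Fin 3 → ℝ) →ᵃ[ℝ] (Fin 3 → ℝ)) where
  carrier := {A | ∀ x ∈ S, A x ∈ tangentSpaceAt S x}
  add_mem' := fun hA hB x hx => add_mem (hA x hx) (hB x hx)
  zero_mem' := fun _ _ => zero_mem _
  smul_mem' := fun c _ hA x hx => Submodule.smul_mem _ c (hA x hx)

/-- The surface `S ⊂ ℝ³` is affinely simply-transitive: `𝔞𝔣𝔣(S) → T_xS` is onto for every `x ∈ S`,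
and `dim 𝔞𝔣𝔣(S) = 2 = dim S`. -/
def IsAffSimplyTransitive (S : Set (Fin 3 → ℝ)) : Prop :=
  (∀ x ∈ S, ∀ v ∈ tangentSpaceAt S x, ∃ A ∈ affSymmetries S, A x = v) ∧
    Module.finrank ℝ (affSymmetries S) = 2

/-- The tube `S + iℝ³ ⊂ ℂ³` with base `S ⊂ ℝ³`. -/
def tubeOver (S : Set (Fin 3 → ℝ)) : Set (Fin 3 → ℂ) :=
  {z | (fun k => (z k).re) ∈ S}

/-- Near `p`, some biholomorphism between open subsets of `ℂ³` maps `M` onto `N`. -/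
def IsLocallyBiholomorphicAt (M N : Set (Fin 3 → ℂ)) (p : Fin 3 → ℂ) : Prop :=
  ∃ φ : OpenPartialHomeomorph (Fin 3 → ℂ) (Fin 3 → ℂ), p ∈ φ.source ∧
    DifferentiableOn ℂ φ φ.source ∧ DifferentiableOn ℂ φ.symm φ.target ∧
    φ '' (M ∩ φ.source) = N ∩ φ.target

/-! Write A for the abelian ideal. Evaluation from `hol M p` onto the tangent space is a surjection
between spaces of dimension 5, so a symmetry vanishing at p is zero (`eq_zero_of_val_eq_zero`).

The heart is that A is totally real at p: V(p) = iU(p) with U, V in A forces U(p) = 0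
(`val_eq_zero_of_null`). Suppose U(p) ≠ 0 and put x = U + iV, x' = U - iV. Levi non-degeneracy
supplies symmetries W, W' with W'(p) = iW(p); put y = W + iW', y' = W - iW'. Both x and y vanish at
p. After multiplying x by a complex constant, [y', x] = R - αx with R in A and iR(p) not tangent to
M; then U, V, R span A, and x', R, y' form a holomorphic frame near p. The Jacobi identity restricts
the structure constants (`structure_constants_of_jacobi`) just enough to solve for the coordinates
of x in this frame: x = cR - (ν/2)c²x' with ν real, c holomorphic and c(p) = 0 (`exists_relation`).
Since U, V, R are tangent to M, this relation makes cx' tangent to M too. So cx' is a symmetry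
vanishing at p, whence c = 0 and x = 0, contradicting [y', x] = R - αx and R(p) ≠ 0
(`null_relations_false`).

Given total reality, a basis f of A is a commuting holomorphic frame, which becomes i∂/∂z_j in
suitable coordinates (`exists_rectifying_coordinates`). Invariance under imaginary translations
makes M a tube (`exists_isTubeChart`). As A is an ideal, each [f_k, g] with g a symmetry is a
constant real combination of the f_j, so g is affine with real linear part in these coordinates
(`exists_affineField_eq`). Thus the symmetry algebra is the affine algebra of the base plus ℝ³ of
imaginary translations, and 5 = 2 + 3. Trivial isotropy passes to the base and gives simple
transitivity of a small connected piece of it (`exists_isAffSimplyTransitive`). -/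

/-! ### Complex structure on germs of vector fields, and representatives -/

namespace HolVectorField

variable {p : Fin 3 → ℂ}

noncomputable instance : SMul ℂ (HolVectorField p) where
  smul c g := ⟨c • g.1, by
    obtain ⟨_, X, hX, rfl⟩ := g
    exact ⟨c • X, hX.const_smul, rfl⟩⟩

noncomputable instance : Module ℂ (HolVectorField p) :=
  Function.Injective.module ℂ (HolVectorField p).subtype.toAddMonoidHom
    Subtype.val_injective fun _ _ => rfl

instance : IsScalarTower ℝ ℂ (HolVectorField p) where
  smul_assoc := by
    rintro a b ⟨_, X, hX, rfl⟩
    refine Subtype.ext (Germ.coe_eq.2 (Eventually.of_forall fun q => ?_))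
    exact smul_assoc a b (X q)

noncomputable instance : LieAlgebra ℂ (HolVectorField p) where
  lie_smul := by
    rintro c ⟨_, X, hX, rfl⟩ ⟨_, Y, hY, rfl⟩
    refine Subtype.ext (Germ.coe_eq.2 ?_)
    filter_upwards [eventually_differentiableAt hY] with q h1
    exact VectorField.lieBracket_const_smul_right h1

/-- Evaluation at `p` of germs of holomorphic vector fields. -/
noncomputable def val : HolVectorField p →ₗ[ℂ] (Fin 3 → ℂ) where
  toFun g := g.1.value
  map_add' := by
    rintro ⟨_, X, hX, rfl⟩ ⟨_, Y, hY, rfl⟩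
    rfl
  map_smul' := by
    rintro c ⟨_, X, hX, rfl⟩
    rfl

/-- A representative of a germ of holomorphic vector fields. -/
noncomputable def rep (g : HolVectorField p) : (Fin 3 → ℂ) → (Fin 3 → ℂ) := g.2.choose

theorem analyticAt_rep (g : HolVectorField p) : AnalyticAt ℂ (rep g) p := g.2.choose_spec.1

theorem coe_rep (g : HolVectorField p) : (rep g : Germ (𝓝 p) (Fin 3 → ℂ)) = g.1 :=
  g.2.choose_spec.2

/-- The germ at `p` of a vector field analytic at `p`. -/
noncomputable def ofAnalytic (X : (Fin 3 → ℂ) → (Fin 3 → ℂ)) (hX : AnalyticAt ℂ X p) :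
    HolVectorField p :=
  ⟨(X : Germ (𝓝 p) (Fin 3 → ℂ)), X, hX, rfl⟩

theorem rep_eventuallyEq {g : HolVectorField p} {X : (Fin 3 → ℂ) → (Fin 3 → ℂ)}
    (h : (X : Germ (𝓝 p) (Fin 3 → ℂ)) = g.1) : rep g =ᶠ[𝓝 p] X :=
  Germ.coe_eq.1 ((coe_rep g).trans h.symm)

theorem rep_ofAnalytic {X : (Fin 3 → ℂ) → (Fin 3 → ℂ)} (hX : AnalyticAt ℂ X p) :
    rep (ofAnalytic X hX) =ᶠ[𝓝 p] X :=
  rep_eventuallyEq rfl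

theorem ext_rep {g h : HolVectorField p} (H : rep g =ᶠ[𝓝 p] rep h) : g = h :=
  Subtype.ext (by rw [← coe_rep g, ← coe_rep h]; exact Germ.coe_eq.2 H)

theorem rep_self (g : HolVectorField p) : rep g p = val g := by
  change _ = g.1.value
  rw [← coe_rep g]; rfl

theorem rep_add (g h : HolVectorField p) : rep (g + h) =ᶠ[𝓝 p] fun q => rep g q + rep h q :=
  rep_eventuallyEq (by
    change _ = g.1 + h.1
    rw [← coe_rep g, ← coe_rep h]; rfl)

theorem rep_smul (c : ℂ) (g : HolVectorField p) : rep (c • g) =ᶠ[𝓝 p] fun q => c • rep g q :=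
  rep_eventuallyEq (by
    change _ = c • g.1
    rw [← coe_rep g]; rfl)

theorem rep_sub (g h : HolVectorField p) : rep (g - h) =ᶠ[𝓝 p] fun q => rep g q - rep h q :=
  rep_eventuallyEq (by
    change _ = g.1 - h.1
    rw [← coe_rep g, ← coe_rep h]; rfl)

theorem rep_zero : rep (0 : HolVectorField p) =ᶠ[𝓝 p] fun _ => 0 :=
  rep_eventuallyEq rfl

theorem rep_lie (g h : HolVectorField p) :
    rep ⁅g, h⁆ =ᶠ[𝓝 p] VectorField.lieBracket ℂ (rep g) (rep h) :=
  rep_eventuallyEq (by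
    rw [coe_bracket, ← coe_rep g, ← coe_rep h]; rfl)

theorem real_smul_eq (c : ℝ) (g : HolVectorField p) : c • g = (c : ℂ) • g :=
  (algebraMap_smul ℂ c g).symm

theorem val_real_smul (c : ℝ) (g : HolVectorField p) : val (c • g) = c • val g := by
  rw [real_smul_eq, map_smul]; rfl

theorem val_lie (g h : HolVectorField p) :
    val ⁅g, h⁆ = fderiv ℂ (rep h) p (val g) - fderiv ℂ (rep g) p (val h) := by
  rw [← rep_self, (rep_lie g h).self_of_nhds, VectorField.lieBracket, rep_self, rep_self]

theorem val_lie_eq_zero {g h : HolVectorField p} (hg : val g = 0) (hh : val h = 0) :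
    val ⁅g, h⁆ = 0 := by
  rw [val_lie, hg, hh]; simp

end HolVectorField

/-! ### Tangent spaces of hypersurfaces -/

section Hypersurface

variable {E : Type*} [NormedAddCommGroup E] [NormedSpace ℝ E] {M : Set E} {p : E} {r : E → ℝ}

/-- A function vanishing on M has an extremum at p along the level set of r, so by Lagrange
multipliers its differential is a multiple of that of r. -/
theorem IsLocalDefiningFunction.mem_tangentSpaceAt_iff [CompleteSpace E]
    (hr : IsLocalDefiningFunction M p r) (hp : p ∈ M) {v : E} :
    v ∈ tangentSpaceAt M p ↔ fderiv ℝ r p v = 0 := by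
  obtain ⟨hra, hr0, hrM⟩ := hr
  refine ⟨fun hv => hv r hra (hrM.mono fun q hq => hq.1), fun hv f hf hfM => ?_⟩
  have hrp : r p = 0 := hrM.self_of_nhds.1 hp
  have hfp : f p = 0 := hfM.self_of_nhds hp
  have hext : IsLocalExtrOn f {x | r x = r p} p := by
    left
    change ∀ᶠ x in 𝓝[{x | r x = r p}] p, f p ≤ f x
    rw [eventually_nhdsWithin_iff]
    filter_upwards [hrM, hfM] with q h1 h2 h3
    rw [h2 (h1.2 (h3.trans hrp)), hfp]
  obtain ⟨a, b, hab, h⟩ := hext.exists_multipliers_of_hasStrictFDerivAt_1d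
    hra.hasStrictFDerivAt hf.hasStrictFDerivAt
  have hb : b ≠ 0 := by
    rintro rfl
    have ha : a ≠ 0 := by rintro rfl; exact hab rfl
    simp only [zero_smul, add_zero, smul_eq_zero] at h
    exact h.elim ha hr0
  have := congrArg (fun l => l v) h
  simp only [add_apply, smul_apply, hv, smul_zero, zero_add, zero_apply] at this
  exact (smul_eq_zero.1 this).resolve_left hb

theorem IsLocalDefiningFunction.eventually (hr : IsLocalDefiningFunction M p r) :
    ∀ᶠ q in 𝓝 p, IsLocalDefiningFunction M q r := by
  obtain ⟨hra, hr0, hrM⟩ := hr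
  filter_upwards [hra.eventually_analyticAt, hrM.eventually_nhds,
    hra.fderiv.continuousAt.eventually_ne hr0] with q h1 h2 h3
  exact ⟨h1, h3, h2⟩

end Hypersurface

/-! ### Isotropy and the Levi form in terms of symmetries -/

section Hol

open HolVectorField

variable {M : Set (Fin 3 → ℂ)} {p : Fin 3 → ℂ} {r : (Fin 3 → ℂ) → ℝ}

theorem mem_hol_iff (hr : IsLocalDefiningFunction M p r) {g : HolVectorField p}
    {X : (Fin 3 → ℂ) → (Fin 3 → ℂ)} (hX : rep g =ᶠ[𝓝 p] X) :
    g ∈ hol M p ↔ ∀ᶠ q in 𝓝 p, q ∈ M → fderiv ℝ r q (X q) = 0 := by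
  constructor
  · rintro ⟨Y, hY, hYt, hYg⟩
    filter_upwards [hr.eventually, hYt, hX, rep_eventuallyEq hYg] with q h1 h2 h3 h4 hq
    rw [← h3, h4]
    exact (h1.mem_tangentSpaceAt_iff hq).1 (h2 hq)
  · intro h
    refine ⟨rep g, analyticAt_rep g, ?_, coe_rep g⟩
    filter_upwards [hr.eventually, h, hX] with q h1 h2 h3 hq
    rw [h3]
    exact (h1.mem_tangentSpaceAt_iff hq).2 (h2 hq)

theorem fderiv_val_eq_zero (hr : IsLocalDefiningFunction M p r) (hp : p ∈ M)
    {g : HolVectorField p} (hg : g ∈ hol M p) : fderiv ℝ r p (val g) = 0 := by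
  rw [← rep_self]
  exact ((mem_hol_iff hr EventuallyEq.rfl).1 hg).self_of_nhds hp

theorem finrank_tangentSpaceAt {F : Type*} [NormedAddCommGroup F]
    [NormedSpace ℝ F] [FiniteDimensional ℝ F] {N : Set F} {q : F} {f : F → ℝ}
    (hf : IsLocalDefiningFunction N q f) (hq : q ∈ N) :
    Module.finrank ℝ (tangentSpaceAt N q) + 1 = Module.finrank ℝ F := by
  have : CompleteSpace F := FiniteDimensional.complete ℝ F
  have h : tangentSpaceAt N q = LinearMap.ker (fderiv ℝ f q : F →ₗ[ℝ] ℝ) := by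
    ext v
    exact hf.mem_tangentSpaceAt_iff hq
  rw [h]
  exact Module.Dual.finrank_ker_add_one_of_ne_zero (f := (fderiv ℝ f q : F →ₗ[ℝ] ℝ))
    fun h0 => hf.2.1 (ContinuousLinearMap.coe_injective h0)

/-- A simply transitive algebra has trivial isotropy. -/
theorem eq_zero_of_val_eq_zero (hst : IsHolSimplyTransitive M)
    (hr : IsLocalDefiningFunction M p r) (hp : p ∈ M) {g : HolVectorField p}
    (hg : g ∈ hol M p) (h0 : val g = 0) : g = 0 := by
  obtain ⟨hsurj, hdim⟩ := hst p hp
  let T := tangentSpaceAt M p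
  let ev : hol M p →ₗ[ℝ] T :=
    { toFun := fun g => ⟨val g.1, (hr.mem_tangentSpaceAt_iff hp).2 (fderiv_val_eq_zero hr hp g.2)⟩
      map_add' := fun a b => Subtype.ext (map_add val a.1 b.1)
      map_smul' := fun c a => Subtype.ext (val_real_smul c a.1) }
  have hev : Function.Surjective ev := by
    rintro ⟨v, hv⟩
    obtain ⟨X, hX, hXv⟩ := hsurj v hv
    exact ⟨⟨X, hX⟩, Subtype.ext hXv⟩
  have : Module.Finite ℝ (hol M p) := Module.finite_of_finrank_pos (by omega)
  have hT : Module.finrank ℝ T = 5 := by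
    have := finrank_tangentSpaceAt hr hp
    rw [Module.finrank_pi_fintype] at this
    simp [Complex.finrank_real_complex] at this
    exact this
  have hinj : Function.Injective ev :=
    (LinearMap.injective_iff_surjective_of_finrank_eq_finrank (hdim.trans hT.symm)).2 hev
  have : (⟨g, hg⟩ : hol M p) = 0 := hinj (by
    rw [map_zero]
    exact Subtype.ext h0)
  exact congrArg Subtype.val this

/-- The Levi form computed with symmetries: a null combination `U + iV` of symmetries has a bracket
with some symmetry `W`, with `W(p)` in the complex tangent space, that leaves the tangent space. -/
theorem exists_fderiv_val_lie_ne_zero (hst : IsHolSimplyTransitive M) (hp : p ∈ M)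
    (hr : IsLocalDefiningFunction M p r)
    (hL : ∀ v : Fin 3 → ℂ, fderiv ℝ r p v = 0 → fderiv ℝ r p (Complex.I • v) = 0 →
      (∀ w : Fin 3 → ℂ, fderiv ℝ r p w = 0 → fderiv ℝ r p (Complex.I • w) = 0 →
        fderiv ℝ (fderiv ℝ r) p v w
          + fderiv ℝ (fderiv ℝ r) p (Complex.I • v) (Complex.I • w) = 0) →
      v = 0)
    {U V : HolVectorField p} (hU : U ∈ hol M p) (hV : V ∈ hol M p) (hUV : val V = Complex.I • val U)
    (h0 : val U ≠ 0) :
    ∃ W ∈ hol M p, ∃ W' ∈ hol M p, val W' = Complex.I • val W ∧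
      fderiv ℝ r p (val ⁅W, U + Complex.I • V⁆) ≠ 0 := by
  by_contra hcon
  push Not at hcon
  refine h0 (hL _ (fderiv_val_eq_zero hr hp hU) (hUV ▸ fderiv_val_eq_zero hr hp hV) ?_)
  intro w hw hIw
  obtain ⟨W, hW, hWw⟩ := (hst p hp).1 w ((hr.mem_tangentSpaceAt_iff hp).2 hw)
  obtain ⟨W', hW', hWw'⟩ := (hst p hp).1 _ ((hr.mem_tangentSpaceAt_iff hp).2 hIw)
  change val W = w at hWw
  change val W' = _ at hWw'
  subst hWw
  have key := hcon W hW W' hW' hWw'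
  -- The function dr(Z) vanishes on M, so its differential kills the tangent vector u. Applied to
  -- (U, w) and (V, iw) and summed, this expresses the Levi form as -dr of the derivative of U + iV
  -- along w. As U + iV vanishes at p, that derivative is the value of [W, U + iV].
  have hd : ∀ {Z : HolVectorField p}, Z ∈ hol M p → ∀ u, fderiv ℝ r p u = 0 →
      fderiv ℝ (fderiv ℝ r) p (val Z) u + fderiv ℝ r p (fderiv ℂ (rep Z) p u) = 0 := by
    intro Z hZ u hu
    have hZa : AnalyticAt ℝ (rep Z) p := (analyticAt_rep Z).restrictScalars
    have han : AnalyticAt ℝ (fun q => fderiv ℝ r q (rep Z q)) p := by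
      have h : ContDiffAt ℝ ⊤ (fun q => fderiv ℝ r q (rep Z q)) p :=
        ContDiffAt.clm_apply hr.1.fderiv.contDiffAt hZa.contDiffAt
      exact h.analyticAt
    have h1 := (hr.mem_tangentSpaceAt_iff hp).2 hu _ han
      ((mem_hol_iff hr EventuallyEq.rfl).1 hZ)
    rw [fderiv_clm_apply hr.1.fderiv.differentiableAt hZa.differentiableAt] at h1
    have hsymm : fderiv ℝ (fderiv ℝ r) p (val Z) u = fderiv ℝ (fderiv ℝ r) p u (val Z) :=
      (hr.1.contDiffAt (n := ⊤)).isSymmSndFDerivAt (by simp) _ _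
    rw [hsymm, ← rep_self]
    rw [(analyticAt_rep Z).differentiableAt.fderiv_restrictScalars ℝ] at h1
    simpa [add_comm] using h1
  have e1 := hd hU _ hw
  have e2 := hd hV _ hIw
  rw [val_lie, map_add, map_smul, hUV, smul_smul, Complex.I_mul_I, neg_one_smul,
    add_neg_cancel, map_zero, sub_zero] at key
  have hder : fderiv ℂ (rep (U + Complex.I • V)) p
      = fderiv ℂ (rep U) p + Complex.I • fderiv ℂ (rep V) p := by
    have : rep (U + Complex.I • V) =ᶠ[𝓝 p] fun q => rep U q + Complex.I • rep V q := by
      filter_upwards [rep_add U (Complex.I • V), rep_smul Complex.I V] with q h1 h2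
      rw [h1, h2]
    rw [this.fderiv_eq, fderiv_fun_add (analyticAt_rep U).differentiableAt
      ((analyticAt_rep V).differentiableAt.fun_const_smul _), fderiv_fun_const_smul
      (analyticAt_rep V).differentiableAt]
  rw [hder] at key
  simp only [add_apply, smul_apply, map_add] at key
  rw [map_smul (fderiv ℂ (rep V) p), hUV] at e2
  linarith

end Hol

/-! ### Dual coframes and uniqueness by Grönwall -/

/-- A frame of analytic vector fields on `ℂ³` has an analytic dual coframe. -/
theorem exists_coframe {F : Fin 3 → (Fin 3 → ℂ) → (Fin 3 → ℂ)} {p : Fin 3 → ℂ}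
    (hF : ∀ j, AnalyticAt ℂ (F j) p) (hli : LinearIndependent ℂ fun j => F j p) :
    ∃ Λ : (Fin 3 → ℂ) → ((Fin 3 → ℂ) →L[ℂ] (Fin 3 → ℂ)), AnalyticAt ℂ Λ p ∧
      ∀ᶠ q in 𝓝 p, (∀ j, Λ q (F j q) = Pi.single j 1) ∧ ∀ v, ∑ j, Λ q v j • F j q = v := by
  let L : (Fin 3 → ℂ) → ((Fin 3 → ℂ) →L[ℂ] (Fin 3 → ℂ)) := fun q =>
    ∑ j, (ContinuousLinearMap.proj (R := ℂ) (φ := fun _ : Fin 3 => ℂ) j).smulRight (F j q)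
  have hLapp : ∀ q v, L q v = ∑ j, v j • F j q := by
    intro q v
    simp [L]
  have hL : AnalyticAt ℂ L p := by
    have h : ContDiffAt ℂ ⊤ L p := by
      refine ContDiffAt.sum fun j _ => ?_
      exact ContDiffAt.smulRight contDiffAt_const (hF j).contDiffAt
    exact h.analyticAt
  have hu : IsUnit (L p) := by
    have hinj : Function.Injective (L p) := by
      rw [injective_iff_map_eq_zero]
      intro v hv
      rw [hLapp] at hv
      exact funext (Fintype.linearIndependent_iff.1 hli v hv)
    let e : (Fin 3 → ℂ) ≃L[ℂ] (Fin 3 → ℂ) :=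
      (LinearEquiv.ofInjectiveEndo
        (L p : (Fin 3 → ℂ) →ₗ[ℂ] (Fin 3 → ℂ)) hinj).toContinuousLinearEquiv
    exact ⟨ContinuousLinearEquiv.unitsEquiv ℂ _ |>.symm e, by ext1 v; rfl⟩
  refine ⟨fun q => Ring.inverse (L q), ?_, ?_⟩
  · have h : ContDiffAt ℂ ⊤ (fun q => Ring.inverse (L q)) p := by
      obtain ⟨u, hu'⟩ := hu
      have := contDiffAt_ringInverse (n := ⊤) ℂ u
      rw [hu'] at this
      exact this.comp p hL.contDiffAt
    exact h.analyticAt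
  · filter_upwards [hL.continuousAt.eventually (Units.isOpen.mem_nhds hu)] with q hq
    have hq' : IsUnit (L q) := hq
    constructor
    · intro j
      have h1 : L q (Pi.single j 1) = F j q := by
        rw [hLapp, Finset.sum_eq_single j]
        · simp
        · intro i _ hij
          simp [hij]
        · simp
      rw [← h1]
      exact congrArg (fun T : (Fin 3 → ℂ) →L[ℂ] (Fin 3 → ℂ) => T (Pi.single j 1))
        (Ring.inverse_mul_cancel _ hq')
    · intro v
      rw [← hLapp]
      exact congrArg (fun T : (Fin 3 → ℂ) →L[ℂ] (Fin 3 → ℂ) => T v)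
        (Ring.mul_inverse_cancel _ hq')

/-- Grönwall's inequality along a segment. -/
theorem eq_zero_of_segment {E G : Type*} [NormedAddCommGroup E] [NormedSpace ℝ E]
    [NormedAddCommGroup G] [NormedSpace ℝ G] {f : E → G} {a b : E} {K : ℝ}
    (hf : ∀ z ∈ segment ℝ a b, DifferentiableAt ℝ f z)
    (hb : ∀ z ∈ segment ℝ a b, ‖fderiv ℝ f z (b - a)‖ ≤ K * ‖f z‖) (ha : f a = 0) : f b = 0 := by
  have hmem : ∀ t ∈ Set.Icc (0 : ℝ) 1, a + t • (b - a) ∈ segment ℝ a b := fun t ht => by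
    rw [segment_eq_image']
    exact ⟨t, ht, rfl⟩
  have hd : ∀ t ∈ Set.Icc (0 : ℝ) 1, HasDerivAt (fun t : ℝ => f (a + t • (b - a)))
      (fderiv ℝ f (a + t • (b - a)) (b - a)) t := by
    intro t ht
    have h1 : HasDerivAt (fun t : ℝ => a + t • (b - a)) (b - a) t := by
      simpa using ((hasDerivAt_id t).smul_const (b - a)).const_add a
    exact (hf _ (hmem t ht)).hasFDerivAt.comp_hasDerivAt t h1
  have := eq_zero_of_abs_deriv_le_mul_abs_self_of_eq_zero_right (K := K)
    (fun t ht => (hd t ht).continuousAt.continuousWithinAt)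
    (fun t ht => (hd t (Set.Ico_subset_Icc_self ht)).hasDerivWithinAt)
    (by simpa using ha) (fun t ht => hb _ (hmem t (Set.Ico_subset_Icc_self ht))) 1
    (by simp)
  simpa using this

/-- A holomorphic function that vanishes at a point and is an eigenvector of every field of a frame
vanishes near that point. -/
theorem eventually_eq_zero_of_frame {F : Fin 3 → (Fin 3 → ℂ) → (Fin 3 → ℂ)} {p : Fin 3 → ℂ}
    (hF : ∀ j, AnalyticAt ℂ (F j) p) (hli : LinearIndependent ℂ fun j => F j p)
    {u : (Fin 3 → ℂ) → ℂ} (hu : AnalyticAt ℂ u p) (c : Fin 3 → ℂ)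
    (h : ∀ᶠ q in 𝓝 p, ∀ j, fderiv ℂ u q (F j q) = c j * u q) (h0 : u p = 0) :
    ∀ᶠ q in 𝓝 p, u q = 0 := by
  obtain ⟨Λ, hΛ, hΛF⟩ := exists_coframe hF hli
  have hbd : ∀ᶠ q in 𝓝 p, ‖Λ q‖ < ‖Λ p‖ + 1 :=
    hΛ.continuousAt.norm.eventually_lt_const (lt_add_one _)
  have hall := (h.and (hΛF.and (hbd.and hu.eventually_analyticAt)))
  obtain ⟨ε, hε, hball⟩ := Metric.eventually_nhds_iff_ball.1 hall
  filter_upwards [Metric.ball_mem_nhds p hε] with q hq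
  have hseg : segment ℝ p q ⊆ Metric.ball p ε :=
    (convex_ball p ε).segment_subset (Metric.mem_ball_self hε) hq
  refine eq_zero_of_segment (a := p) (f := u) (K := ∑ j, (‖Λ p‖ + 1) * ‖q - p‖ * ‖c j‖)
    (fun z hz => ((hball z (hseg hz)).2.2.2.differentiableAt.restrictScalars ℝ)) ?_ h0
  intro z hz
  obtain ⟨h1, ⟨_, h2⟩, h3, h4⟩ := hball z (hseg hz)
  rw [h4.differentiableAt.fderiv_restrictScalars ℝ, ContinuousLinearMap.coe_restrictScalars',
    ← h2 (q - p), map_sum, Finset.sum_mul]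
  refine (norm_sum_le _ _).trans (Finset.sum_le_sum fun j _ => ?_)
  rw [map_smul, h1 j, norm_smul, norm_mul, ← mul_assoc]
  gcongr
  rw [h2]
  exact (norm_le_pi_norm _ j).trans ((Λ z).le_of_opNorm_le h3.le _)

open scoped ComplexConjugate

/-! ### Structure constants forced by the Jacobi identity -/

section Jacobi

variable {L : Type*} [LieRing L] [LieAlgebra ℂ L] {x x' R y y' n : L} {μ α a : ℂ}

/-- Expand [[y, y'], x] by Jacobi. In the application n lies in the complexified abelian ideal, so
it contributes nothing. -/
theorem lie_eq_of_jacobi (hx : ⁅y, x⁆ = μ • x) (hx' : ⁅y', x⁆ = R - α • x)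
    (hy : ⁅y, y'⁆ = a • y - conj a • y' + n) (hnx : ⁅n, x⁆ = 0) :
    ⁅y, R⁆ = (a * μ + conj a * α) • x + (μ - conj a) • R := by
  have h := lie_lie y y' x
  simp only [hx, hx', hy, add_lie, sub_lie, smul_lie, lie_sub, lie_smul, hnx] at h
  linear_combination (norm := module) -h

/-- The formal conjugate of `lie_eq_of_jacobi`, exchanging x with x' and y with y'. Since `L`
carries no conjugation here, Jacobi is expanded again. -/
theorem lie_eq_of_jacobi_conj (hx : ⁅y', x'⁆ = conj μ • x') (hx' : ⁅y, x'⁆ = R - conj α • x')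
    (hy : ⁅y, y'⁆ = a • y - conj a • y' + n) (hnx : ⁅n, x'⁆ = 0) :
    ⁅y', R⁆ = conj (a * μ + conj a * α) • x' + (conj μ - a) • R := by
  have h := lie_lie y y' x'
  simp only [hx, hx', hy, add_lie, sub_lie, smul_lie, lie_sub, lie_smul, hnx] at h
  simp only [map_add, map_mul, Complex.conj_conj]
  linear_combination (norm := module) h

theorem structure_constants_of_jacobi (hli : LinearIndependent ℂ ![x, x', R])
    (hx' : ⁅y', x⁆ = R - α • x) (hxb' : ⁅y, x'⁆ = R - conj α • x')
    (hy : ⁅y, y'⁆ = a • y - conj a • y' + n) (hnR : ⁅n, R⁆ = 0) {ν : ℂ}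
    (hν : ν = a * μ + conj a * α)
    (hR : ⁅y, R⁆ = ν • x + (μ - conj a) • R) (hR' : ⁅y', R⁆ = conj ν • x' + (conj μ - a) • R) :
    ν * (conj μ + α - 2 * a) = 0 ∧ conj ν = ν := by
  have h := lie_lie y y' R
  simp only [hx', hxb', hy, hR, hR', add_lie, sub_lie, smul_lie, lie_add, lie_smul, hnR] at h
  have h' : (ν * (conj μ + α - 2 * a)) • x + (-(conj ν * (μ + conj α - 2 * conj a))) • x'
      + (conj ν - ν - (a * μ - conj a * conj μ)) • R = 0 := by
    linear_combination (norm := module) -h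
  have h0 := Fintype.linearIndependent_iff.1 hli
    ![ν * (conj μ + α - 2 * a), -(conj ν * (μ + conj α - 2 * conj a)),
      conj ν - ν - (a * μ - conj a * conj μ)] (by simpa [Fin.sum_univ_three] using h')
  have e0 := h0 0
  have e2 := h0 2
  simp only [Matrix.cons_val] at e0 e2
  refine ⟨e0, ?_⟩
  -- If ν ≠ 0, the x-coefficient gives conj μ = 2a - α. Substituting, the R-coefficient becomes 3(a
  -- conj α - α conj a), while conj ν - ν is 2(a conj α - α conj a); hence the factor 2/3.
  rcases mul_eq_zero.1 e0 with h1 | h1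
  · simp [h1]
  · have hμ : conj μ = 2 * a - α := by linear_combination h1
    have hμ' : μ = 2 * conj a - conj α := by
      have := congrArg conj hμ
      simpa [Complex.conj_ofNat] using this
    rw [hν] at e2 ⊢
    simp only [map_add, map_mul, Complex.conj_conj] at e2 ⊢
    rw [hμ, hμ'] at e2 ⊢
    linear_combination (2 / 3 : ℂ) * e2

end Jacobi

/-! ### Solving for a null field in a frame -/

section Relation

open HolVectorField VectorField

variable {p : Fin 3 → ℂ}

/-- The derivatives of the coordinates of a vector field with respect to a frame. -/
theorem fderiv_coord_apply {f : Fin 3 → HolVectorField p}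
    {Λ : (Fin 3 → ℂ) → ((Fin 3 → ℂ) →L[ℂ] (Fin 3 → ℂ))} (hΛ : AnalyticAt ℂ Λ p)
    (hΛf : ∀ᶠ q in 𝓝 p, (∀ j, Λ q (rep (f j) q) = Pi.single j 1) ∧
      ∀ v, ∑ j, Λ q v j • rep (f j) q = v) (x g : HolVectorField p) :
    ∀ᶠ q in 𝓝 p, ∀ i, fderiv ℂ (fun z => Λ z (rep x z) i) q (rep g q) =
      Λ q (rep ⁅g, x⁆ q) i - ∑ j, Λ q (rep x q) j * Λ q (rep ⁅g, f j⁆ q) i := by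
  have hk : ∀ᶠ q in 𝓝 p, ∀ j, DifferentiableAt ℂ (fun z => Λ z (rep x z) j) q := by
    filter_upwards [hΛ.eventually_analyticAt, (analyticAt_rep x).eventually_analyticAt]
      with q h1 h2 j
    exact differentiableAt_pi.1 (h1.differentiableAt.clm_apply h2.differentiableAt) j
  have hf : ∀ᶠ q in 𝓝 p, ∀ j, DifferentiableAt ℂ (rep (f j)) q :=
    eventually_all.2 fun j => eventually_differentiableAt (analyticAt_rep (f j))
  have hlie : ∀ᶠ q in 𝓝 p, ∀ j, rep ⁅g, f j⁆ q = lieBracket ℂ (rep g) (rep (f j)) q :=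
    eventually_all.2 fun j => rep_lie g (f j)
  filter_upwards [hΛf, hk, hf, rep_lie g x, hlie, hΛf.eventually_nhds]
    with q ⟨h1, _⟩ h3 h4 h5 h6 h7 i
  have hx : rep x =ᶠ[𝓝 q] fun z => ∑ j, Λ z (rep x z) j • rep (f j) z :=
    h7.mono fun z hz => (hz.2 _).symm
  have hbr : rep ⁅g, x⁆ q = ∑ j, (fderiv ℂ (fun z => Λ z (rep x z) j) q (rep g q) • rep (f j) q
      + Λ q (rep x q) j • rep ⁅g, f j⁆ q) := by
    rw [h5, EventuallyEq.rfl.lieBracket_vectorField_eq hx]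
    simp only [h6]
    simp only [Fin.sum_univ_three]
    have hd : ∀ j, DifferentiableAt ℂ (fun z => Λ z (rep x z) j • rep (f j) z) q :=
      fun j => (h3 j).smul (h4 j)
    have := lieBracket_add_right (V := rep g) ((hd 0).add (hd 1)) (hd 2)
    refine this.trans ?_
    rw [lieBracket_add_right (hd 0) (hd 1), lieBracket_smul_right (h3 0) (h4 0),
      lieBracket_smul_right (h3 1) (h4 1), lieBracket_smul_right (h3 2) (h4 2)]
  rw [hbr, map_sum, Finset.sum_apply]
  simp only [map_add, map_smul, h1, Pi.add_apply, Pi.smul_apply, smul_eq_mul,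
    Finset.sum_add_distrib, Pi.single_apply]
  simp

/-- Let k₀, k₁, k₂ be the coordinates of x in the frame x', R, y; all vanish at p. The brackets give
their derivatives along the frame. Both k₂ and k₀ + (ν/2)k₁² are eigenfunctions of every frame
field, hence zero by `eventually_eq_zero_of_frame`, and c is k₁. -/
theorem exists_relation {x x' R y : HolVectorField p} {α μ ν κ : ℂ} (hx : val x = 0)
    (hli : LinearIndependent ℂ ![val x', val R, val y]) (h1 : ⁅x', x⁆ = 0) (h2 : ⁅R, x⁆ = 0)
    (h3 : ⁅x', R⁆ = 0) (h4 : ⁅y, x⁆ = R - α • x) (h5 : ⁅y, x'⁆ = μ • x')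
    (h6 : ⁅y, R⁆ = ν • x' + κ • R) (h7 : ν * (α + μ) = 2 * (ν * (α + κ))) :
    ∃ c : (Fin 3 → ℂ) → ℂ, AnalyticAt ℂ c p ∧ c p = 0 ∧
      ∀ᶠ q in 𝓝 p, rep x q = c q • rep R q - (ν / 2 * c q ^ 2) • rep x' q := by
  let f : Fin 3 → HolVectorField p := ![x', R, y]
  have hfli : LinearIndependent ℂ fun j => rep (f j) p := by
    convert hli using 1
    ext j : 1
    rw [rep_self]
    fin_cases j <;> rfl
  have hfa : ∀ j, AnalyticAt ℂ (rep (f j)) p := fun j => analyticAt_rep _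
  obtain ⟨Λ, hΛ, hΛf⟩ := exists_coframe hfa hfli
  have hk : ∀ j, AnalyticAt ℂ (fun z => Λ z (rep x z) j) p := by
    intro j
    have h : ContDiffAt ℂ ⊤ (fun z => Λ z (rep x z) j) p :=
      contDiffAt_pi.1 (hΛ.contDiffAt.clm_apply (analyticAt_rep x).contDiffAt) j
    exact h.analyticAt
  have hk0 : ∀ j, Λ p (rep x p) j = 0 := fun j => by rw [rep_self, hx, map_zero]; rfl
  have hyx : ∀ᶠ q in 𝓝 p, rep ⁅y, x⁆ q = rep R q - α • rep x q := by
    rw [h4]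
    filter_upwards [rep_sub R (α • x), rep_smul α x] with q e1 e2
    rw [e1, e2]
  have hyR : ∀ᶠ q in 𝓝 p, rep ⁅y, R⁆ q = ν • rep x' q + κ • rep R q := by
    rw [h6]
    filter_upwards [rep_add (ν • x') (κ • R), rep_smul ν x', rep_smul κ R] with q e1 e2 e3
    rw [e1, e2, e3]
  have hyx' : ∀ᶠ q in 𝓝 p, rep ⁅y, x'⁆ q = μ • rep x' q := by
    rw [h5]; exact rep_smul μ x'
  have hx'y : ∀ᶠ q in 𝓝 p, rep ⁅x', y⁆ q = (-μ) • rep x' q := by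
    rw [← lie_skew, h5, ← neg_smul]; exact rep_smul (-μ) x'
  have hRy : ∀ᶠ q in 𝓝 p, rep ⁅R, y⁆ q = (-ν) • rep x' q + (-κ) • rep R q := by
    rw [← lie_skew, h6, neg_add, ← neg_smul, ← neg_smul]
    filter_upwards [rep_add ((-ν) • x') ((-κ) • R), rep_smul (-ν) x', rep_smul (-κ) R]
      with q e1 e2 e3
    rw [e1, e2, e3]
  have h3' : ⁅R, x'⁆ = 0 := by rw [← lie_skew, h3, neg_zero]
  have hder : ∀ᶠ q in 𝓝 p,
      (fderiv ℂ (fun z => Λ z (rep x z) 2) q (rep x' q) = 0 ∧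
       fderiv ℂ (fun z => Λ z (rep x z) 2) q (rep R q) = 0 ∧
       fderiv ℂ (fun z => Λ z (rep x z) 2) q (rep y q) = -α * Λ q (rep x q) 2) ∧
      (fderiv ℂ (fun z => Λ z (rep x z) 1) q (rep x' q) = 0 ∧
       fderiv ℂ (fun z => Λ z (rep x z) 1) q (rep R q) = κ * Λ q (rep x q) 2 ∧
       fderiv ℂ (fun z => Λ z (rep x z) 1) q (rep y q) = 1 - (α + κ) * Λ q (rep x q) 1) ∧
      (fderiv ℂ (fun z => Λ z (rep x z) 0) q (rep x' q) = μ * Λ q (rep x q) 2 ∧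
       fderiv ℂ (fun z => Λ z (rep x z) 0) q (rep R q) = ν * Λ q (rep x q) 2 ∧
       fderiv ℂ (fun z => Λ z (rep x z) 0) q (rep y q)
        = -(α + μ) * Λ q (rep x q) 0 - ν * Λ q (rep x q) 1) := by
    filter_upwards [fderiv_coord_apply hΛ hΛf x x', fderiv_coord_apply hΛ hΛf x R,
      fderiv_coord_apply hΛ hΛf x y, hΛf, hyx, hyR, hyx', hx'y, hRy, rep_zero (p := p)]
      with q e1 e2 e3 ⟨e4, _⟩ e5 e6 e7 e8 e9 e10
    have a0 : Λ q (rep x' q) = Pi.single 0 1 := e4 0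
    have a1 : Λ q (rep R q) = Pi.single 1 1 := e4 1
    refine ⟨⟨?_, ?_, ?_⟩, ⟨?_, ?_, ?_⟩, ⟨?_, ?_, ?_⟩⟩ <;>
    simp [e1, e2, e3, f, Fin.sum_univ_three, h1, h2, h3, h3', e5, e6, e7, e8, e9, e10, a0, a1] <;>
    ring
  have hk2 : ∀ᶠ q in 𝓝 p, Λ q (rep x q) 2 = 0 := by
    refine eventually_eq_zero_of_frame hfa hfli (hk 2) ![0, 0, -α] ?_ (hk0 2)
    filter_upwards [hder] with q ⟨⟨e1, e2, e3⟩, _⟩ j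
    fin_cases j
    · simpa [f] using e1
    · simpa [f] using e2
    · simpa [f] using e3
  -- Along y the linear terms in k₁ cancel, and what remains is -(α + μ)k₀ - ν(α + κ)k₁². The
  -- hypothesis `h7` is exactly what makes this -(α + μ) times the function itself.
  have hu : ∀ᶠ q in 𝓝 p, Λ q (rep x q) 0 + ν / 2 * Λ q (rep x q) 1 ^ 2 = 0 := by
    have hua : AnalyticAt ℂ (fun q => Λ q (rep x q) 0 + ν / 2 * Λ q (rep x q) 1 ^ 2) p :=
      (hk 0).add (analyticAt_const.mul ((hk 1).pow 2))
    refine eventually_eq_zero_of_frame hfa hfli hua ![0, 0, -(α + μ)] ?_ (by simp [hk0])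
    filter_upwards [hder, hk2, (hk 0).eventually_analyticAt, (hk 1).eventually_analyticAt]
      with q ⟨_, ⟨e1, e2, e3⟩, ⟨e4, e5, e6⟩⟩ e7 e8 e9
    have hd : ∀ v, fderiv ℂ (fun q => Λ q (rep x q) 0 + ν / 2 * Λ q (rep x q) 1 ^ 2) q v
        = fderiv ℂ (fun z => Λ z (rep x z) 0) q v
          + ν * Λ q (rep x q) 1 * fderiv ℂ (fun z => Λ z (rep x z) 1) q v := by
      intro v
      have := e8.differentiableAt.hasFDerivAt.fun_add
        ((e9.differentiableAt.hasFDerivAt.pow 2).const_mul (ν / 2))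
      rw [HasFDerivAt.fderiv this]
      simp
      ring
    intro j
    rw [hd]
    fin_cases j
    · simp [f, e1, e4, e7]
    · simp [f, e2, e5, e7]
    · simp [f, e3, e6]
      linear_combination (1 / 2 * Λ q (rep x q) 1 ^ 2) * h7
  refine ⟨fun z => Λ z (rep x z) 1, hk 1, hk0 1, ?_⟩
  filter_upwards [hk2, hu, hΛf] with q e1 e2 ⟨_, e3⟩
  have := e3 (rep x q)
  rw [Fin.sum_univ_three, e1, zero_smul, add_zero] at this
  have e0 : Λ q (rep x q) 0 = -(ν / 2 * Λ q (rep x q) 1 ^ 2) := by linear_combination e2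
  rw [e0] at this
  change _ • rep x' q + _ • rep R q = _ at this
  refine this.symm.trans ?_
  module

end Relation

/-! ### Real-linear functionals on complex vector spaces -/

theorem ContinuousLinearMap.map_complex_smul_eq {F : Type*} [NormedAddCommGroup F] [NormedSpace ℂ F]
    (l : F →L[ℝ] ℝ) (z : ℂ) (v : F) :
    l (z • v) = z.re * l v + z.im * l (Complex.I • v) := by
  have h : z • v = z.re • v + z.im • Complex.I • v := by
    conv_lhs => rw [← Complex.re_add_im z]
    rw [add_smul, mul_smul]
    simp only [Complex.coe_smul]
  rw [h, map_add, map_smul, map_smul, smul_eq_mul, smul_eq_mul]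

/-- If real-linear `l` kills `u`, `v`, `w` and `u + iv = c w - b c² (u - iv)` with `b` real, then
`l` kills `c (u - iv)`. -/
theorem ContinuousLinearMap.map_smul_conj_eq_zero {F : Type*} [NormedAddCommGroup F]
    [NormedSpace ℂ F] (l : F →L[ℝ] ℝ) {u v w : F} {c : ℂ} {b : ℝ} (hu : l u = 0) (hv : l v = 0)
    (hw : l w = 0)
    (h : u + Complex.I • v = c • w - ((b : ℂ) * c ^ 2) • (u - Complex.I • v))
    (hc : b * (c.re ^ 2 + c.im ^ 2) ≠ 1) : l (c • (u - Complex.I • v)) = 0 := by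
  have h1 := congrArg l h
  have h2 := congrArg (fun t => l (Complex.I • t)) h
  simp only [smul_sub, smul_add, smul_smul, map_add, map_sub, l.map_complex_smul_eq (_ * _),
    l.map_complex_smul_eq c, hu, hv, hw, pow_two] at h1 h2 ⊢
  simp at h1 h2 ⊢
  -- Write l = Re θ with θ complex-linear. As l kills u and v, θ(u - iv) = -conj θ(u + iv), and θ(w)
  -- is imaginary. Multiplying the relation by conj c and taking real parts gives (1 - b|c|²)
  -- Re(conj c · θ(u + iv)) = 0; the second factor is -l(c(u - iv)).
  have key : (1 - b * (c.re ^ 2 + c.im ^ 2)) *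
      (c.im * l (Complex.I • u) - c.re * l (Complex.I • v)) = 0 := by
    linear_combination c.im * h2 - c.re * h1
  rcases mul_eq_zero.1 key with h3 | h3
  · exact absurd (by linear_combination -h3) hc
  · linear_combination h3

/-! ### The contradiction from a null pair in the ideal -/

section Null

open HolVectorField

variable {M : Set (Fin 3 → ℂ)} {p : Fin 3 → ℂ} {r : (Fin 3 → ℂ) → ℝ}

/-- The relation x = cR - (ν/2)c²x' turns cx' into a symmetry with value 0 at p. Trivial isotropy
then gives c = 0, so x = 0, which the bracket of y' with x excludes. -/
theorem null_relations_false (hst : IsHolSimplyTransitive M) (hp : p ∈ M)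
    (hr : IsLocalDefiningFunction M p r) {U V R x x' y y' n : HolVectorField p} {μ α a : ℂ}
    (hU : U ∈ hol M p) (hV : V ∈ hol M p) (hR : R ∈ hol M p)
    (hx : x = U + Complex.I • V) (hx' : x' = U - Complex.I • V)
    (hx0 : val x = 0) (hli : LinearIndependent ℂ ![val x', val R, val y'])
    (hxx : ⁅x', x⁆ = 0) (hRx : ⁅R, x⁆ = 0) (hx'R : ⁅x', R⁆ = 0)
    (hyx : ⁅y, x⁆ = μ • x) (hyx' : ⁅y', x'⁆ = conj μ • x') (hy'x : ⁅y', x⁆ = R - α • x)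
    (hy'x' : ⁅y, x'⁆ = R - conj α • x') (hyy : ⁅y, y'⁆ = a • y - conj a • y' + n)
    (hnx : ⁅n, x⁆ = 0) (hnx' : ⁅n, x'⁆ = 0) (hnR : ⁅n, R⁆ = 0) : False := by
  have hR0 : val R ≠ 0 := by simpa using hli.ne_zero 1
  have hx'0 : val x' ≠ 0 := by simpa using hli.ne_zero 0
  have hxne : x ≠ 0 := by
    rintro h
    rw [h, lie_zero, smul_zero, sub_zero] at hy'x
    exact hR0 (by rw [← hy'x, map_zero])
  have hli' : LinearIndependent ℂ ![x, x', R] := by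
    rw [Fintype.linearIndependent_iff]
    intro g hg
    simp only [Fin.sum_univ_three, Matrix.cons_val] at hg
    have h1 := congrArg val hg
    simp only [map_add, map_smul, hx0, smul_zero, zero_add, map_zero] at h1
    have h2 := Fintype.linearIndependent_iff.1 hli ![g 1, g 2, 0]
      (by simpa [Fin.sum_univ_three] using h1)
    have e1 : g 1 = 0 := h2 0
    have e2 : g 2 = 0 := h2 1
    rw [e1, e2, zero_smul, zero_smul, add_zero, add_zero] at hg
    have e0 : g 0 = 0 := (smul_eq_zero.1 hg).resolve_right hxne
    intro i
    fin_cases i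
    exacts [e0, e1, e2]
  have hyR := lie_eq_of_jacobi hyx hy'x hyy hnx
  have hy'R := lie_eq_of_jacobi_conj hyx' hy'x' hyy hnx'
  obtain ⟨hν0, hνr⟩ := structure_constants_of_jacobi hli' hy'x hy'x' hyy hnR rfl hyR hy'R
  set ν := a * μ + conj a * α with hν
  rw [hνr] at hy'R
  obtain ⟨c, hca, hc0, hc⟩ := exists_relation hx0 hli hxx hRx hx'R hy'x hyx' hy'R
    (by linear_combination -hν0)
  obtain ⟨b, hb⟩ : ∃ b : ℝ, (b : ℂ) = ν / 2 :=
    ⟨ν.re / 2, by push_cast; rw [Complex.conj_eq_iff_re.1 hνr]⟩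
  rw [← hb] at hc
  have hsa : AnalyticAt ℂ (fun q => c q • rep x' q) p := hca.smul (analyticAt_rep x')
  have hs : ofAnalytic _ hsa ∈ hol M p := by
    rw [mem_hol_iff hr (rep_ofAnalytic hsa)]
    -- Since c(p) = 0, the factor 1 - b|c|² is nonzero near p.
    have hcc : ∀ᶠ q in 𝓝 p, b * ((c q).re ^ 2 + (c q).im ^ 2) < 1 := by
      have hcont : ContinuousAt (fun q => b * ((c q).re ^ 2 + (c q).im ^ 2)) p := by
        have := hca.continuousAt
        fun_prop
      refine hcont.eventually_lt_const ?_
      simp [hc0]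
    filter_upwards [hc, (mem_hol_iff hr EventuallyEq.rfl).1 hU,
      (mem_hol_iff hr EventuallyEq.rfl).1 hV, (mem_hol_iff hr EventuallyEq.rfl).1 hR, hcc,
      rep_add U (Complex.I • V), rep_sub U (Complex.I • V), rep_smul Complex.I V]
      with q e1 e2 e3 e4 e5 e6 e7 e8 hq
    rw [hx, hx', e6, e7, e8] at e1
    rw [hx', e7, e8]
    exact ContinuousLinearMap.map_smul_conj_eq_zero _ (e2 hq) (e3 hq) (e4 hq) e1 e5.ne
  have hs0 := eq_zero_of_val_eq_zero hst hr hp hs (by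
    rw [← rep_self, (rep_ofAnalytic hsa).self_of_nhds]
    simp [hc0])
  refine hxne (ext_rep ?_)
  have hz := rep_ofAnalytic hsa
  rw [hs0] at hz
  filter_upwards [hz, rep_zero (p := p), hc,
    (analyticAt_rep x').continuousAt.eventually_ne (y := 0) (by rwa [rep_self])] with q e1 e2 e3 e4
  rw [e2] at e1
  have : c q = 0 := (smul_eq_zero.1 e1.symm).resolve_right e4
  rw [e3, e2, this]
  simp

theorem Submodule.exists_sum_eq_of_linearIndependent {K L : Type*} [Field K] [AddCommGroup L]
    [Module K L] (A : Submodule K L) {m : ℕ} (hm : Module.finrank K A = m) (hm0 : 0 < m)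
    {f : Fin m → L}
    (hf : LinearIndependent K f) (hfA : ∀ i, f i ∈ A) {z : L} (hz : z ∈ A) :
    ∃ c : Fin m → K, ∑ i, c i • f i = z := by
  have : Module.Finite K A := Module.finite_of_finrank_pos (by omega)
  have h : span K (Set.range f) = A := by
    refine eq_of_le_of_finrank_eq (span_le.2 ?_) ?_
    · rintro _ ⟨i, rfl⟩
      exact hfA i
    · rw [finrank_span_eq_card hf, hm, Fintype.card_fin]
  rw [← h] at hz
  exact (mem_span_range_iff_exists_fun K).1 hz

end Null

/-! ### Brackets of complex combinations -/

section ComplexLie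

variable {L : Type*} [LieRing L] [LieAlgebra ℂ L] (a b c d : L)

theorem lie_add_I_add_I : ⁅a + Complex.I • b, c + Complex.I • d⁆
    = (⁅a, c⁆ - ⁅b, d⁆) + Complex.I • (⁅a, d⁆ + ⁅b, c⁆) := by
  simp only [add_lie, lie_add, smul_lie, lie_smul]
  linear_combination (norm := module) Complex.I_mul_I • ⁅b, d⁆

theorem lie_sub_I_sub_I : ⁅a - Complex.I • b, c - Complex.I • d⁆
    = (⁅a, c⁆ - ⁅b, d⁆) - Complex.I • (⁅a, d⁆ + ⁅b, c⁆) := by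
  simp only [sub_lie, lie_sub, smul_lie, lie_smul]
  linear_combination (norm := module) Complex.I_mul_I • ⁅b, d⁆

theorem lie_sub_I_add_I : ⁅a - Complex.I • b, c + Complex.I • d⁆
    = (⁅a, c⁆ + ⁅b, d⁆) + Complex.I • (⁅a, d⁆ - ⁅b, c⁆) := by
  simp only [sub_lie, lie_add, smul_lie, lie_smul]
  linear_combination (norm := module) (-Complex.I_mul_I) • ⁅b, d⁆

theorem lie_add_I_sub_I : ⁅a + Complex.I • b, c - Complex.I • d⁆
    = (⁅a, c⁆ + ⁅b, d⁆) - Complex.I • (⁅a, d⁆ - ⁅b, c⁆) := by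
  simp only [add_lie, lie_sub, smul_lie, lie_smul]
  linear_combination (norm := module) (-Complex.I_mul_I) • ⁅b, d⁆

end ComplexLie

/-! ### Total reality of the ideal -/

section Null

open HolVectorField

variable {M : Set (Fin 3 → ℂ)} {p : Fin 3 → ℂ} {r : (Fin 3 → ℂ) → ℝ}

/-- A symmetry is determined by its value at p, and cU(p) = Re c · U(p) + Im c · V(p). -/
theorem eq_combination_of_val_eq (hst : IsHolSimplyTransitive M) (hp : p ∈ M)
    (hr : IsLocalDefiningFunction M p r) {U V g : HolVectorField p} (hU : U ∈ hol M p)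
    (hV : V ∈ hol M p) (hg : g ∈ hol M p) (hUV : val V = Complex.I • val U) {c : ℂ}
    (h : val g = c • val U) : g = (c.re : ℂ) • U + (c.im : ℂ) • V := by
  have hmem : g - (c.re • U + c.im • V) ∈ hol M p :=
    sub_mem hg (add_mem ((hol M p).smul_mem _ hU) ((hol M p).smul_mem _ hV))
  have h0 := eq_zero_of_val_eq_zero hst hr hp hmem (by
    rw [map_sub, map_add, val_real_smul, val_real_smul, h, hUV]
    simp only [← Complex.coe_smul]
    linear_combination (norm := module) (-Complex.re_add_im c) • val U)
  rw [sub_eq_zero] at h0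
  rw [h0, real_smul_eq, real_smul_eq]

/-- Rescaling a null combination of elements of the ideal so that its Levi bracket is real modulo
the complex tangent space. -/
theorem exists_normalized_null (hst : IsHolSimplyTransitive M) (hp : p ∈ M)
    (hr : IsLocalDefiningFunction M p r)
    (hL : ∀ v : Fin 3 → ℂ, fderiv ℝ r p v = 0 → fderiv ℝ r p (Complex.I • v) = 0 →
      (∀ w : Fin 3 → ℂ, fderiv ℝ r p w = 0 → fderiv ℝ r p (Complex.I • w) = 0 →
        fderiv ℝ (fderiv ℝ r) p v w
          + fderiv ℝ (fderiv ℝ r) p (Complex.I • v) (Complex.I • w) = 0) →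
      v = 0)
    {A : Submodule ℝ (HolVectorField p)} (hA : ∀ g ∈ A, g ∈ hol M p)
    (hid : ∀ g ∈ hol M p, ∀ h ∈ A, ⁅g, h⁆ ∈ A)
    {U₀ V₀ : HolVectorField p} (hU₀ : U₀ ∈ A) (hV₀ : V₀ ∈ A)
    (hUV : val V₀ = Complex.I • val U₀) (h0 : val U₀ ≠ 0) :
    ∃ U ∈ A, ∃ V ∈ A, ∃ W ∈ hol M p, ∃ W' ∈ hol M p, val V = Complex.I • val U ∧ val U ≠ 0 ∧
      val W' = Complex.I • val W ∧
      fderiv ℝ r p (Complex.I • val (⁅W, U⁆ + ⁅W', V⁆)) ≠ 0 ∧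
      fderiv ℝ r p (Complex.I • val (⁅W, V⁆ - ⁅W', U⁆)) = 0 := by
  obtain ⟨W, hW, W', hW', hWW, hne⟩ :=
    exists_fderiv_val_lie_ne_zero hst hp hr hL (hA _ hU₀) (hA _ hV₀) hUV h0
  set l := fderiv ℝ r p with hl
  have hnull : val ⁅W + Complex.I • W', U₀ + Complex.I • V₀⁆ = 0 := by
    refine val_lie_eq_zero ?_ ?_ <;>
    simp [hWW, hUV, smul_smul]
  have hZ1 : l (val (⁅W, U₀⁆ + ⁅W', V₀⁆)) = 0 :=
    fderiv_val_eq_zero hr hp (hA _ (add_mem (hid _ hW _ hU₀) (hid _ hW' _ hV₀)))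
  set k₁ : ℝ := l (Complex.I • val (⁅W, U₀⁆ + ⁅W', V₀⁆)) with hk₁
  set k₂ : ℝ := l (Complex.I • val (⁅W, V₀⁆ - ⁅W', U₀⁆)) with hk₂
  have hk : k₂ ≠ 0 := by
    intro hk0
    -- Split 2W = (W + iW') + (W - iW'). The first bracket vanishes at p because both factors do, so
    -- the nonzero Levi value comes from the second.
    have e : (2 : ℝ) • ⁅W, U₀ + Complex.I • V₀⁆ = ⁅W + Complex.I • W', U₀ + Complex.I • V₀⁆
        + ((⁅W, U₀⁆ + ⁅W', V₀⁆) + Complex.I • (⁅W, V₀⁆ - ⁅W', U₀⁆)) := by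
      rw [real_smul_eq, lie_add_I_add_I, lie_add, lie_smul]
      push_cast
      module
    have e' := congrArg (fun t => l (val t)) e
    simp only [val_real_smul, map_smul l] at e'
    rw [map_add val, hnull, zero_add, map_add val, map_add l, hZ1, map_smul val, ← hk₂, hk0] at e'
    refine hne ?_
    simpa using e'
  -- This is U + iV = (k₁ - ik₂)(U₀ + iV₀). Multiplying the Levi value k₁ + ik₂ by its conjugate
  -- makes it k₁² + k₂² > 0, with imaginary part 0.
  refine ⟨k₁ • U₀ + k₂ • V₀, add_mem (A.smul_mem _ hU₀) (A.smul_mem _ hV₀),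
    (-k₂) • U₀ + k₁ • V₀, add_mem (A.smul_mem _ hU₀) (A.smul_mem _ hV₀), W, hW, W', hW',
    ?_, ?_, hWW, ?_, ?_⟩
  · rw [map_add, map_add, val_real_smul, val_real_smul, val_real_smul, val_real_smul, hUV]
    simp only [← Complex.coe_smul]
    push_cast
    linear_combination (norm := module) (-(k₂ : ℂ) * Complex.I_mul_I) • val U₀
  · have e : val (k₁ • U₀ + k₂ • V₀) = ((k₁ : ℂ) + k₂ * Complex.I) • val U₀ := by
      rw [map_add, val_real_smul, val_real_smul, hUV]
      simp only [← Complex.coe_smul]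
      module
    rw [e]
    refine smul_ne_zero ?_ h0
    intro hz
    have := congrArg Complex.im hz
    simp at this
    exact hk this
  · have e : ⁅W, k₁ • U₀ + k₂ • V₀⁆ + ⁅W', (-k₂) • U₀ + k₁ • V₀⁆
        = k₁ • (⁅W, U₀⁆ + ⁅W', V₀⁆) + k₂ • (⁅W, V₀⁆ - ⁅W', U₀⁆) := by
      simp only [lie_add, lie_smul]
      module
    rw [e, map_add, val_real_smul, val_real_smul, smul_add, smul_comm, smul_comm _ k₂,
      map_add, map_smul l, map_smul l, ← hk₁, ← hk₂, smul_eq_mul, smul_eq_mul]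
    have := mul_self_nonneg k₁
    have := mul_self_pos.2 hk
    linarith
  · have e : ⁅W, (-k₂) • U₀ + k₁ • V₀⁆ - ⁅W', k₁ • U₀ + k₂ • V₀⁆
        = (-k₂) • (⁅W, U₀⁆ + ⁅W', V₀⁆) + k₁ • (⁅W, V₀⁆ - ⁅W', U₀⁆) := by
      simp only [lie_add, lie_smul]
      module
    rw [e, map_add, val_real_smul, val_real_smul, smul_add, smul_comm, smul_comm _ k₁,
      map_add, map_smul l, map_smul l, ← hk₁, ← hk₂, smul_eq_mul, smul_eq_mul]
    ring

/-- An abelian three-dimensional ideal of symmetries is totally real at the base point. -/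
theorem val_eq_zero_of_null (hst : IsHolSimplyTransitive M) (hp : p ∈ M)
    (hr : IsLocalDefiningFunction M p r)
    (hL : ∀ v : Fin 3 → ℂ, fderiv ℝ r p v = 0 → fderiv ℝ r p (Complex.I • v) = 0 →
      (∀ w : Fin 3 → ℂ, fderiv ℝ r p w = 0 → fderiv ℝ r p (Complex.I • w) = 0 →
        fderiv ℝ (fderiv ℝ r) p v w
          + fderiv ℝ (fderiv ℝ r) p (Complex.I • v) (Complex.I • w) = 0) →
      v = 0)
    {A : Submodule ℝ (HolVectorField p)} (hA : ∀ g ∈ A, g ∈ hol M p)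
    (hid : ∀ g ∈ hol M p, ∀ h ∈ A, ⁅g, h⁆ ∈ A) (hab : ∀ g ∈ A, ∀ h ∈ A, ⁅g, h⁆ = 0)
    (hdim : Module.finrank ℝ A = 3)
    {U₀ V₀ : HolVectorField p} (hU₀ : U₀ ∈ A) (hV₀ : V₀ ∈ A)
    (hUV₀ : val V₀ = Complex.I • val U₀) : val U₀ = 0 := by
  by_contra h0
  obtain ⟨U, hU, V, hV, W, hW, W', hW', hUV, hU0, hWW, hZ1, hZ2⟩ :=
    exists_normalized_null hst hp hr hL hA hid hU₀ hV₀ hUV₀ h0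
  set l := fderiv ℝ r p with hl
  set Z₁ := ⁅W, U⁆ + ⁅W', V⁆ with hZ₁
  set Z₂ := ⁅W, V⁆ - ⁅W', U⁆ with hZ₂
  have hZ₁A : Z₁ ∈ A := add_mem (hid _ hW _ hU) (hid _ hW' _ hV)
  have hZ₂A : Z₂ ∈ A := sub_mem (hid _ hW _ hV) (hid _ hW' _ hU)
  have lU : l (val U) = 0 := fderiv_val_eq_zero hr hp (hA _ hU)
  have lV : l (val V) = 0 := fderiv_val_eq_zero hr hp (hA _ hV)
  have lW : l (val W) = 0 := fderiv_val_eq_zero hr hp hW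
  have lIU : l (Complex.I • val U) = 0 := hUV ▸ lV
  have lIV : l (Complex.I • val V) = 0 := by
    rw [hUV, smul_smul, Complex.I_mul_I, neg_one_smul, map_neg, lU, neg_zero]
  have lIW : l (Complex.I • val W) = 0 := hWW ▸ fderiv_val_eq_zero hr hp hW'
  -- As iZ₁(p) is not tangent, U, V, Z₁ form a basis of the three-dimensional A, and l(i·) reads off
  -- the Z₁-coordinate.
  have hspan : ∀ g ∈ A, l (Complex.I • val g) = 0 →
      ∃ m₁ m₂ : ℝ, g = (m₁ : ℂ) • U + (m₂ : ℂ) • V := by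
    intro g hg hg0
    have hli : LinearIndependent ℝ ![U, V, Z₁] := by
      rw [Fintype.linearIndependent_iff]
      intro k hk
      simp only [Fin.sum_univ_three, Matrix.cons_val] at hk
      have e := congrArg (fun t => l (Complex.I • val t)) hk
      simp only [map_add, val_real_smul, smul_add, smul_comm Complex.I, map_smul, lIU, lIV,
        smul_zero, zero_add, map_zero, smul_eq_zero, hZ1, or_false] at e
      rw [e, zero_smul, add_zero] at hk
      have e' := congrArg val hk
      have e'' : ((k 0 : ℂ) + k 1 * Complex.I) • val U = 0 := by
        rw [← map_zero (val (p := p)), ← e', map_add, val_real_smul, val_real_smul, hUV,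
          ← Complex.coe_smul, ← Complex.coe_smul]
        module
      have e3 := (smul_eq_zero.1 e'').resolve_right hU0
      have e4 := congrArg Complex.re e3
      have e5 := congrArg Complex.im e3
      simp at e4 e5
      intro i
      fin_cases i
      exacts [e4, e5, e]
    obtain ⟨c, hc⟩ := A.exists_sum_eq_of_linearIndependent hdim (by norm_num) hli
      (by intro i; fin_cases i <;> assumption) hg
    simp only [Fin.sum_univ_three, Matrix.cons_val] at hc
    have e := congrArg (fun t => l (Complex.I • val t)) hc
    simp only [map_add, val_real_smul, smul_add, smul_comm Complex.I, map_smul, lIU, lIV,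
      smul_zero, zero_add, hg0, smul_eq_zero, hZ1, or_false] at e
    refine ⟨c 0, c 1, ?_⟩
    rw [← hc, e, zero_smul, add_zero, real_smul_eq, real_smul_eq]
  have hcomb := fun {g : HolVectorField p} (hg : g ∈ hol M p) {c : ℂ} (h : val g = c • val U) =>
    eq_combination_of_val_eq hst hp hr (hA _ hU) (hA _ hV) hg hUV h
  -- the eigenvalue `μ`
  set P := ⁅W, U⁆ - ⁅W', V⁆ with hP
  set Q := ⁅W, V⁆ + ⁅W', U⁆ with hQ
  have hPA : P ∈ A := sub_mem (hid _ hW _ hU) (hid _ hW' _ hV)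
  have hQA : Q ∈ A := add_mem (hid _ hW _ hV) (hid _ hW' _ hU)
  have hPQ : val P + Complex.I • val Q = 0 := by
    have hnull : val ⁅W + Complex.I • W', U + Complex.I • V⁆ = 0 := by
      refine val_lie_eq_zero ?_ ?_ <;>
      simp [hWW, hUV, smul_smul]
    rw [← hnull, ← map_smul, ← map_add, lie_add_I_add_I]
  have hQP : val Q = Complex.I • val P := by
    have e := congrArg (fun t => Complex.I • t) hPQ
    simp only [smul_add, smul_smul, Complex.I_mul_I, smul_zero] at e
    linear_combination (norm := module) -e
  obtain ⟨m₁, m₂, hPm⟩ := hspan P hPA (by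
    rw [← hQP]; exact fderiv_val_eq_zero hr hp (hA _ hQA))
  have hQm : Q = (-m₂ : ℂ) • U + (m₁ : ℂ) • V := by
    have := hcomb (hA _ hQA) (c := -m₂ + m₁ * Complex.I) (by
      rw [hQP, hPm, map_add, map_smul, map_smul, hUV]
      linear_combination (norm := module) ((m₂ : ℂ) * Complex.I_mul_I) • val U)
    simpa using this
  -- the bracket with `W - iW'`
  obtain ⟨n₁, n₂, hZn⟩ := hspan Z₂ hZ₂A hZ2
  -- With Z₂ = n₁U + n₂V, this correction makes Z₁ + iZ₂ = R - αx for α = -n₂ - in₁, while R stays a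
  -- real element of A.
  set R := Z₁ + (-n₂) • U + n₁ • V with hRdef
  have hRA : R ∈ A := add_mem (add_mem hZ₁A (A.smul_mem _ hU)) (A.smul_mem _ hV)
  have lR : l (val R) = 0 := fderiv_val_eq_zero hr hp (hA _ hRA)
  have lIR : l (Complex.I • val R) ≠ 0 := by
    simpa only [hRdef, map_add, val_real_smul, smul_add, smul_comm Complex.I, map_smul, lIU, lIV,
      smul_zero, add_zero] using hZ1
  have hCI : ∀ k₁ k₂ k₃ : ℂ, k₁ • val U + k₂ • val R + k₃ • val W = 0 →
      k₁ = 0 ∧ k₂ = 0 ∧ k₃ = 0 := by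
    intro k₁ k₂ k₃ hk
    have e1 := congrArg l hk
    have e2 := congrArg (fun t => l (Complex.I • t)) hk
    simp only [smul_add, smul_smul, map_add, l.map_complex_smul_eq (_ * _),
      l.map_complex_smul_eq k₁, l.map_complex_smul_eq k₂, l.map_complex_smul_eq k₃, lU, lIU, lR,
      lW, lIW, mul_zero, zero_add, add_zero, map_zero, smul_zero, mul_eq_zero, lIR, or_false]
      at e1 e2
    simp only [Complex.mul_im, Complex.I_re, Complex.I_im, zero_mul, one_mul, zero_add] at e2
    have hk2 : k₂ = 0 := Complex.ext e2 e1
    rw [hk2, zero_smul, add_zero] at hk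
    -- If W(p) were a complex multiple of U(p), then W and W' would be real combinations of U and V,
    -- and Z₁ would vanish because A is abelian.
    have hk3 : k₃ = 0 := by
      by_contra hk3
      have hw : val W = (-(k₁ / k₃)) • val U := by
        have : k₃ • val W = k₃ • (-(k₁ / k₃)) • val U := by
          rw [smul_smul, mul_neg, mul_div_cancel₀ _ hk3]
          linear_combination (norm := module) hk
        exact smul_right_injective _ hk3 this
      have hWc := hcomb hW hw
      have hWc' := hcomb hW' (hWW.trans ((congrArg (fun t => Complex.I • t) hw).trans
        (smul_smul _ _ _)))
      refine hZ1 ?_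
      rw [hZ₁, hWc, hWc']
      simp [hab U hU V hV, hab V hV U hU]
    rw [hk3, zero_smul, add_zero] at hk
    exact ⟨(smul_eq_zero.1 hk).resolve_right hU0, hk2, hk3⟩
  -- the bracket of `W` and `W'`
  have hli5 : LinearIndependent ℝ ![U, V, R, W, W'] := by
    rw [Fintype.linearIndependent_iff]
    intro k hk
    simp only [Fin.sum_univ_five, Matrix.cons_val] at hk
    have e := congrArg val hk
    simp only [map_add, val_real_smul, hUV, hWW, map_zero] at e
    obtain ⟨e1, e2, e3⟩ := hCI (k 0 + k 1 * Complex.I) (k 2) (k 3 + k 4 * Complex.I) (by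
      rw [← e]
      simp only [← Complex.coe_smul]
      module)
    have a0 := congrArg Complex.re e1
    have a1 := congrArg Complex.im e1
    have a2 := congrArg Complex.re e2
    have a3 := congrArg Complex.re e3
    have a4 := congrArg Complex.im e3
    simp at a0 a1 a2 a3 a4
    intro i
    fin_cases i
    exacts [a0, a1, a2, a3, a4]
  obtain ⟨c, hc⟩ := (hol M p).toSubmodule.exists_sum_eq_of_linearIndependent (hst p hp).2
    (by norm_num) hli5
    (by
      intro i
      fin_cases i
      exacts [hA _ hU, hA _ hV, hA _ hRA, hW, hW'])
    (LieSubalgebra.lie_mem _ hW hW' : ⁅W, W'⁆ ∈ hol M p)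
  simp only [Fin.sum_univ_five, Matrix.cons_val, real_smul_eq] at hc
  have hUU : ⁅U, V⁆ = 0 := hab _ hU _ hV
  have hVU : ⁅V, U⁆ = 0 := hab _ hV _ hU
  have hUR : ⁅U, R⁆ = 0 := hab _ hU _ hRA
  have hVR : ⁅V, R⁆ = 0 := hab _ hV _ hRA
  have hRU : ⁅R, U⁆ = 0 := hab _ hRA _ hU
  have hRV : ⁅R, V⁆ = 0 := hab _ hRA _ hV
  have hI := Complex.I_mul_I
  have hvx' : val (U - Complex.I • V) = (2 : ℂ) • val U := by
    rw [map_sub, map_smul, hUV, smul_smul, hI]; module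
  have hvy' : val (W - Complex.I • W') = (2 : ℂ) • val W := by
    rw [map_sub, map_smul, hWW, smul_smul, hI]; module
  simp only [real_smul_eq] at hRdef
  -- Here μ comes from [y, x] = P + iQ and α from Z₂. In [y, y'] = -2i[W, W'], the W and W'
  -- components form ay - (conj a)y'; the rest, n, lies in the complexified ideal and commutes with
  -- x, x', R.
  refine null_relations_false hst hp hr (U := U) (V := V) (R := R) (y := W + Complex.I • W')
    (y' := W - Complex.I • W') (μ := m₁ - m₂ * Complex.I) (α := -n₂ - n₁ * Complex.I)
    (a := -c 4 - c 3 * Complex.I)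
    (n := (-2 * Complex.I) • ((c 0 : ℂ) • U + (c 1 : ℂ) • V + (c 2 : ℂ) • R))
    (hA _ hU) (hA _ hV) (hA _ hRA) rfl rfl ?_ ?_ ?_ ?_ ?_ ?_ ?_ ?_ ?_ ?_ ?_ ?_ ?_
  · rw [map_add, map_smul, hUV, smul_smul, hI]; module
  · rw [Fintype.linearIndependent_iff]
    intro k hk
    simp only [Fin.sum_univ_three, Matrix.cons_val, hvx', hvy'] at hk
    obtain ⟨e1, e2, e3⟩ := hCI (2 * k 0) (k 1) (2 * k 2) (by rw [← hk]; module)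
    intro i
    fin_cases i
    · simpa using e1
    · exact e2
    · simpa using e3
  · simp [hUU, hVU]
  · simp [hRU, hRV]
  · simp [hUR, hVR]
  · rw [lie_add_I_add_I, ← hP, ← hQ, hPm, hQm]
    linear_combination (norm := module) ((m₂ : ℂ) * hI) • V
  · rw [lie_sub_I_sub_I, ← hP, ← hQ, hPm, hQm]
    simp only [map_sub, map_mul, Complex.conj_ofReal, Complex.conj_I]
    linear_combination (norm := module) ((m₂ : ℂ) * hI) • V
  · rw [lie_sub_I_add_I, ← hZ₁, ← hZ₂, hZn, hRdef]
    push_cast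
    linear_combination (norm := module) ((-n₁ : ℂ) * hI) • V
  · rw [lie_add_I_sub_I, ← hZ₁, ← hZ₂, hZn, hRdef]
    simp only [map_sub, map_neg, map_mul, Complex.conj_ofReal, Complex.conj_I]
    push_cast
    linear_combination (norm := module) ((-n₁ : ℂ) * hI) • V
  · have e : ⁅W + Complex.I • W', W - Complex.I • W'⁆ = (-2 * Complex.I) • ⁅W, W'⁆ := by
      have : ⁅W', W⁆ = -⁅W, W'⁆ := (lie_skew _ _).symm
      simp only [add_lie, lie_sub, smul_lie, lie_smul, lie_self, this]
      module
    rw [e, ← hc]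
    simp only [map_sub, map_neg, map_mul, Complex.conj_ofReal, Complex.conj_I]
    module
  · simp [hUU, hVU, hRU, hRV]
  · simp [hUU, hVU, hRU, hRV]
  · simp [hUR, hVR]

end Null

/-! ### Analyticity of primitives -/

/-- A function whose derivative is analytic is analytic. -/
theorem analyticAt_of_hasFDerivAt {E F : Type*} [NormedAddCommGroup E] [NormedSpace ℂ E]
    [NormedAddCommGroup F] [NormedSpace ℂ F] [CompleteSpace E] [CompleteSpace F]
    {f : E → F} {f' : E → E →L[ℂ] F}
    {x : E} (hf' : AnalyticAt ℂ f' x) (hf : ∀ᶠ y in 𝓝 x, HasFDerivAt f (f' y) y) :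
    AnalyticAt ℂ f x := by
  obtain ⟨q, R, hq⟩ := hf'
  obtain ⟨ε, hε, hball⟩ := Metric.eventually_nhds_iff_ball.1 hf
  have hq' : HasFPowerSeriesOnBall f' q x (min R (ENNReal.ofReal ε)) :=
    hq.mono (lt_min hq.r_pos (ENNReal.ofReal_pos.2 hε)) (min_le_left _ _)
  set ρ := min R (ENNReal.ofReal ε) with hρ
  -- Integrating f'(x + ty)y over t in [0, 1] term by term turns t^n into 1/(n + 1), so f(x + y) =
  -- f(x) + (ΣQ)(y) y.
  let Q : FormalMultilinearSeries ℂ E (E →L[ℂ] F) := fun n => ((n + 1 : ℕ) : ℂ)⁻¹ • q n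
  have hQn : ∀ n, ‖Q n‖ ≤ ‖q n‖ := by
    intro n
    have h1 : ‖((n + 1 : ℕ) : ℂ)⁻¹‖ ≤ 1 := by
      rw [norm_inv, Complex.norm_natCast]
      exact inv_le_one_of_one_le₀ (by exact_mod_cast Nat.le_add_left 1 n)
    calc ‖Q n‖ ≤ ‖((n + 1 : ℕ) : ℂ)⁻¹‖ * ‖q n‖ := ContinuousMultilinearMap.opNorm_smul_le _ _
      _ ≤ 1 * ‖q n‖ := by gcongr
      _ = ‖q n‖ := one_mul _
  have hQrad : q.radius ≤ Q.radius := by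
    refine ENNReal.le_of_forall_nnreal_lt fun s hs => ?_
    obtain ⟨C, -, hC⟩ := q.norm_mul_pow_le_of_lt_radius hs
    exact Q.le_radius_of_bound C fun n =>
      (mul_le_mul_of_nonneg_right (hQn n) (by positivity)).trans (hC n)
  have hQpos : 0 < Q.radius := hq.r_pos.trans_le (hq.r_le.trans hQrad)
  have hQs : HasFPowerSeriesOnBall Q.sum Q 0 Q.radius := Q.hasFPowerSeriesOnBall hQpos
  have key : ∀ y ∈ Metric.eball (0 : E) ρ, f (x + y) = f x + Q.sum y y := by
    intro y hy
    have hyR : y ∈ Metric.eball (0 : E) R := Metric.eball_subset_eball (min_le_left _ _) hy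
    have hyε : ‖y‖ < ε := by
      have : y ∈ Metric.eball (0 : E) (ENNReal.ofReal ε) :=
        Metric.eball_subset_eball (min_le_right _ _) hy
      rw [Metric.eball_ofReal] at this
      simpa using this
    have hty : ∀ t ∈ Set.Icc (0 : ℝ) 1, ‖t • y‖ ≤ ‖y‖ := by
      intro t ht
      rw [norm_smul, Real.norm_of_nonneg ht.1]
      exact mul_le_of_le_one_left (norm_nonneg _) ht.2
    have htR : ∀ t ∈ Set.Icc (0 : ℝ) 1, t • y ∈ Metric.eball (0 : E) R := by
      intro t ht
      rw [Metric.mem_eball, edist_zero_right] at hyR ⊢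
      refine lt_of_le_of_lt ?_ hyR
      rw [← ofReal_norm, ← ofReal_norm]
      exact ENNReal.ofReal_le_ofReal (hty t ht)
    have htε : ∀ t ∈ Set.Icc (0 : ℝ) 1, x + t • y ∈ Metric.ball x ε := by
      intro t ht
      simpa using (hty t ht).trans_lt hyε
    have hterm : ∀ t : ℝ, ∀ n, (q n fun _ => t • y) y = t ^ n • (q n fun _ => y) y := by
      intro t n
      have : (q n fun _ => t • y) = (t : ℂ) ^ n • q n fun _ => y := by
        have h := (q n).map_smul_univ (fun _ => (t : ℂ)) (fun _ => y)
        simpa using h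
      rw [this, smul_apply, ← Complex.ofReal_pow, Complex.coe_smul]
    have hderiv : ∀ t ∈ Set.uIcc (0 : ℝ) 1,
        HasDerivAt (fun t : ℝ => f (x + t • y)) (f' (x + t • y) y) t := by
      intro t ht
      rw [Set.uIcc_of_le zero_le_one] at ht
      have h1 : HasDerivAt (fun t : ℝ => x + t • y) y t := by
        simpa using ((hasDerivAt_id t).smul_const y).const_add x
      exact ((hball _ (htε t ht)).restrictScalars ℝ).comp_hasDerivAt t h1
    have hcont : ContinuousOn (fun t : ℝ => f' (x + t • y) y) (Set.uIcc 0 1) := by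
      rw [Set.uIcc_of_le zero_le_one]
      have h1 : ContinuousOn (fun t : ℝ => f' (x + t • y)) (Set.Icc 0 1) := by
        refine hq.continuousOn.comp (by fun_prop) fun t ht => ?_
        have := htR t ht
        rw [Metric.mem_eball, edist_zero_right] at this
        rw [Metric.mem_eball, edist_eq_enorm_sub]
        simpa using this
      exact h1.clm_apply continuousOn_const
    have hint := intervalIntegral.integral_eq_sub_of_hasDerivAt hderiv hcont.intervalIntegrable
    have hsummable : Summable fun n => ‖q n fun _ => y‖ * ‖y‖ :=
      (q.summable_norm_apply (Metric.eball_subset_eball hq.r_le hyR)).mul_right _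
    have hsum : HasSum (fun n : ℕ => ∫ t in (0 : ℝ)..1, t ^ n • (q n fun _ => y) y)
        (∫ t in (0 : ℝ)..1, f' (x + t • y) y) := by
      refine intervalIntegral.hasSum_integral_of_dominated_convergence
        (fun n _ => ‖q n fun _ => y‖ * ‖y‖) (fun n => ?_) (fun n => ?_) ?_ ?_ ?_
      · exact (Continuous.aestronglyMeasurable (by fun_prop))
      · refine Eventually.of_forall fun t ht => ?_
        rw [Set.uIoc_of_le zero_le_one] at ht
        rw [norm_smul, norm_pow, Real.norm_of_nonneg ht.1.le]
        calc t ^ n * ‖(q n fun _ => y) y‖ ≤ 1 * (‖q n fun _ => y‖ * ‖y‖) := by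
              gcongr
              · exact pow_le_one₀ ht.1.le ht.2
              · exact ContinuousLinearMap.le_opNorm _ _
          _ = _ := one_mul _
      · exact Eventually.of_forall fun t _ => hsummable
      · exact intervalIntegrable_const
      · refine Eventually.of_forall fun t ht => ?_
        rw [Set.uIoc_of_le zero_le_one] at ht
        have h1 := hq.hasSum (htR t ⟨ht.1.le, ht.2⟩)
        have h2 := (ContinuousLinearMap.apply ℂ F y).hasSum h1
        simpa only [Function.comp_def, ContinuousLinearMap.apply_apply, hterm] using h2
    have hQsum : HasSum (fun n : ℕ => (Q n fun _ => y) y) (Q.sum y y) := by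
      have h1 := hQs.hasSum (Metric.eball_subset_eball (hq.r_le.trans hQrad) hyR)
      rw [zero_add] at h1
      have h2 := (ContinuousLinearMap.apply ℂ F y).hasSum h1
      simpa only [Function.comp_def, ContinuousLinearMap.apply_apply] using h2
    have heq : (fun n : ℕ => ∫ t in (0 : ℝ)..1, t ^ n • (q n fun _ => y) y)
        = fun n : ℕ => (Q n fun _ => y) y := by
      funext n
      rw [intervalIntegral.integral_smul_const, integral_pow]
      have h1 : (Q n fun _ => y) y = ((n + 1 : ℕ) : ℂ)⁻¹ • (q n fun _ => y) y := rfl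
      have h2 : ((n + 1 : ℕ) : ℂ)⁻¹ = (((n + 1 : ℝ)⁻¹ : ℝ) : ℂ) := by push_cast; rfl
      rw [h1, h2, Complex.coe_smul]
      simp
    rw [heq] at hsum
    have := hQsum.unique hsum
    rw [this, hint]
    simp
  have han : AnalyticAt ℂ (fun z => f x + Q.sum (z - x) (z - x)) x := by
    have h1 : AnalyticAt ℂ Q.sum ((fun z : E => z - x) x) := by
      simpa using hQs.analyticAt
    have h2 : AnalyticAt ℂ (fun z : E => z - x) x := analyticAt_id.sub analyticAt_const
    have h3 : AnalyticAt ℂ (fun z => Q.sum (z - x)) x :=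
      AnalyticAt.comp (g := Q.sum) (f := fun z => z - x) h1 h2
    have h4 : ContDiffAt ℂ ⊤ (fun z => Q.sum (z - x) (z - x)) x :=
      h3.contDiffAt.clm_apply h2.contDiffAt
    exact analyticAt_const.add h4.analyticAt
  refine han.congr ?_
  have hρpos : 0 < ρ := hq'.r_pos
  filter_upwards [Metric.eball_mem_nhds x hρpos] with z hz
  rw [Metric.mem_eball, edist_eq_enorm_sub] at hz
  have := key (z - x) (by rwa [Metric.mem_eball, edist_zero_right])
  rw [add_sub_cancel] at this
  exact this.symm

/-! ### Simultaneous rectification of commuting fields -/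

section Rectification

open HolVectorField VectorField

variable {p : Fin 3 → ℂ}

/-- The coframe is closed: its pairings with the frame are constant, so its exterior derivative on
f_i, f_j is minus its value on [f_i, f_j] = 0. -/
theorem fderiv_coframe_symm {f : Fin 3 → HolVectorField p} (hcomm : ∀ i j, ⁅f i, f j⁆ = 0)
    {Λ : (Fin 3 → ℂ) → ((Fin 3 → ℂ) →L[ℂ] (Fin 3 → ℂ))} (hΛ : AnalyticAt ℂ Λ p)
    (hΛf : ∀ᶠ q in 𝓝 p, (∀ j, Λ q (rep (f j) q) = Pi.single j 1) ∧
      ∀ v, ∑ j, Λ q v j • rep (f j) q = v) :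
    ∀ᶠ q in 𝓝 p, ∀ v w, fderiv ℂ Λ q v w = fderiv ℂ Λ q w v := by
  have hlie : ∀ᶠ q in 𝓝 p, ∀ i j, lieBracket ℂ (rep (f i)) (rep (f j)) q = 0 := by
    refine eventually_all.2 fun i => eventually_all.2 fun j => ?_
    have h := rep_lie (f i) (f j)
    rw [hcomm i j] at h
    filter_upwards [h, rep_zero (p := p)] with q h1 h2
    rw [← h1, h2]
  have hf : ∀ᶠ q in 𝓝 p, ∀ j, DifferentiableAt ℂ (rep (f j)) q :=
    eventually_all.2 fun j => eventually_differentiableAt (analyticAt_rep (f j))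
  filter_upwards [hlie, hf, hΛ.eventually_analyticAt, hΛf, hΛf.eventually_nhds]
    with q h1 h2 h3 ⟨_, h4⟩ h5
  have hd : ∀ j v, fderiv ℂ Λ q v (rep (f j) q) = -Λ q (fderiv ℂ (rep (f j)) q v) := by
    intro j v
    have e1 : (fun z => Λ z (rep (f j) z)) =ᶠ[𝓝 q] fun _ => Pi.single j 1 :=
      h5.mono fun z hz => hz.1 j
    have e2 := e1.fderiv_eq (𝕜 := ℂ)
    rw [fderiv_clm_apply h3.differentiableAt (h2 j)] at e2
    have e3 := congrArg (fun l => l v) e2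
    simp at e3
    exact eq_neg_of_add_eq_zero_right e3
  have hij : ∀ i j, fderiv ℂ Λ q (rep (f i) q) (rep (f j) q)
      = fderiv ℂ Λ q (rep (f j) q) (rep (f i) q) := by
    intro i j
    have := h1 i j
    rw [lieBracket, sub_eq_zero] at this
    rw [hd, hd, this]
  intro v w
  rw [← h4 v, ← h4 w]
  simp only [map_sum, map_smul, sum_apply, smul_apply, Finset.smul_sum]
  rw [Finset.sum_comm]
  refine Finset.sum_congr rfl fun i _ => Finset.sum_congr rfl fun j _ => ?_
  rw [hij j i, smul_comm]

/-- The Poincaré lemma on a ball integrates the closed coframe. The factor i makes the fields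
imaginary translations. -/
theorem exists_rectifying_function {f : Fin 3 → HolVectorField p} (hcomm : ∀ i j, ⁅f i, f j⁆ = 0)
    (hli : LinearIndependent ℂ fun j => val (f j)) :
    ∃ φ : (Fin 3 → ℂ) → (Fin 3 → ℂ), AnalyticAt ℂ φ p ∧
      ∀ᶠ q in 𝓝 p, ∀ j, fderiv ℂ φ q (rep (f j) q) = Pi.single j Complex.I := by
  obtain ⟨Λ, hΛ, hΛf⟩ := exists_coframe (F := fun j => rep (f j)) (fun j => analyticAt_rep _)
    (by simpa only [rep_self] using hli)
  have hsymm := fderiv_coframe_symm hcomm hΛ hΛf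
  obtain ⟨ε, hε, hball⟩ :=
    Metric.eventually_nhds_iff_ball.1 (hsymm.and (hΛ.eventually_analyticAt.and hΛf))
  obtain ⟨φ, hφ⟩ := (convex_ball p ε).exists_forall_hasFDerivAt_of_fderiv_symmetric
    (ω := Λ) Metric.isOpen_ball
    (fun q hq => ((hball q hq).2.1.differentiableAt.restrictScalars ℝ).differentiableWithinAt)
    (fun q hq v w => by
      rw [(hball q hq).2.1.differentiableAt.fderiv_restrictScalars ℝ]
      exact (hball q hq).1 v w)
  have hφe : ∀ᶠ q in 𝓝 p, HasFDerivAt φ (Λ q) q := by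
    filter_upwards [Metric.ball_mem_nhds p hε] with q hq using hφ q hq
  have hφa : AnalyticAt ℂ φ p := analyticAt_of_hasFDerivAt hΛ hφe
  refine ⟨fun q => Complex.I • φ q, analyticAt_const.fun_smul hφa, ?_⟩
  filter_upwards [hφe, hΛf] with q h1 ⟨h2, _⟩ j
  rw [(h1.fun_const_smul Complex.I).fderiv, smul_apply, h2 j]
  ext i
  simp [Pi.single_apply]

/-- Commuting holomorphic vector fields that are independent at `p` are the constant fields
`i ∂/∂z_j` in suitable holomorphic coordinates. -/
theorem exists_rectifying_coordinates {f : Fin 3 → HolVectorField p}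
    (hcomm : ∀ i j, ⁅f i, f j⁆ = 0) (hli : LinearIndependent ℂ fun j => val (f j)) :
    ∃ Φ : OpenPartialHomeomorph (Fin 3 → ℂ) (Fin 3 → ℂ), p ∈ Φ.source ∧
      (∀ q ∈ Φ.source, AnalyticAt ℂ Φ q) ∧ (∀ z ∈ Φ.target, AnalyticAt ℂ Φ.symm z) ∧
      ∀ q ∈ Φ.source, ∀ j, fderiv ℂ Φ q (rep (f j) q) = Pi.single j Complex.I := by
  obtain ⟨φ, hφ, hφf⟩ := exists_rectifying_function hcomm hli
  have hequiv : ∀ q, (∀ j, fderiv ℂ φ q (rep (f j) q) = Pi.single j Complex.I) →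
      ∃ e : (Fin 3 → ℂ) ≃L[ℂ] (Fin 3 → ℂ), fderiv ℂ φ q = e := by
    intro q hq
    have hsurj : Function.Surjective (fderiv ℂ φ q : (Fin 3 → ℂ) →ₗ[ℂ] (Fin 3 → ℂ)) := by
      intro v
      refine ⟨∑ j, (-Complex.I * v j) • rep (f j) q, ?_⟩
      rw [ContinuousLinearMap.coe_coe, map_sum]
      simp only [map_smul, hq]
      ext i
      simp only [Finset.sum_apply, Pi.smul_apply, Pi.single_apply, smul_eq_mul, mul_ite, mul_zero,
        Finset.sum_ite_eq, Finset.mem_univ, if_true]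
      linear_combination -(v i) * Complex.I_mul_I
    have hinj := LinearMap.injective_iff_surjective.2 hsurj
    exact ⟨(LinearEquiv.ofInjectiveEndo _ hinj).toContinuousLinearEquiv, by ext1 v; rfl⟩
  obtain ⟨e, he⟩ := hequiv p hφf.self_of_nhds
  have hstrict : HasStrictFDerivAt φ (e : (Fin 3 → ℂ) →L[ℂ] (Fin 3 → ℂ)) p := by
    rw [← he]; exact hφ.hasStrictFDerivAt
  obtain ⟨s, hs, hso, hps⟩ := eventually_nhds_iff.1 (hφ.eventually_analyticAt.and hφf)
  let Φ := (hstrict.toOpenPartialHomeomorph φ).restrOpen s hso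
  have hΦ : ∀ q ∈ Φ.source, q ∈ s := fun q hq => by
    rw [OpenPartialHomeomorph.restrOpen_source] at hq
    exact hq.2
  have hcoe : (Φ : (Fin 3 → ℂ) → (Fin 3 → ℂ)) = φ := rfl
  refine ⟨Φ, ?_, fun q hq => (hs q (hΦ q hq)).1, fun z hz => ?_, fun q hq => (hs q (hΦ q hq)).2⟩
  · rw [OpenPartialHomeomorph.restrOpen_source]
    exact ⟨hstrict.mem_toOpenPartialHomeomorph_source, hps⟩
  · have hq := Φ.map_target hz
    obtain ⟨e', he'⟩ := hequiv _ (hs _ (hΦ _ hq)).2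
    have := Φ.analyticAt_symm' (i := e') hq (hs _ (hΦ _ hq)).1 he'
    rwa [Φ.right_inv hz] at this

end Rectification

/-! ### Straightening a regular zero set -/

section Straightening

variable {F : Type*} [NormedAddCommGroup F] [NormedSpace ℝ F] [CompleteSpace F]

/-- A function with nonzero differential becomes linear in suitable coordinates, which are tangent
to the identity at the base point. -/
theorem exists_straightening {r : F → ℝ} {p : F} (hr : AnalyticAt ℝ r p)
    (hr0 : fderiv ℝ r p ≠ 0) :
    ∃ Ψ : OpenPartialHomeomorph F F, p ∈ Ψ.source ∧ (∀ q, fderiv ℝ r p (Ψ q) = r q) ∧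
      HasStrictFDerivAt Ψ.symm (ContinuousLinearMap.id ℝ F) (Ψ p) := by
  obtain ⟨n, hn⟩ : ∃ n, fderiv ℝ r p n = 1 := by
    obtain ⟨v, hv⟩ := DFunLike.exists_ne hr0
    refine ⟨(fderiv ℝ r p v)⁻¹ • v, ?_⟩
    rw [map_smul, smul_eq_mul]
    exact inv_mul_cancel₀ hv
  -- As dr_p(n) = 1, applying dr_p to ψ gives r; the correction is flat to first order at p.
  let ψ : F → F := fun q => q + (r q - fderiv ℝ r p q) • n
  have hψ : HasStrictFDerivAt ψ
      ((ContinuousLinearEquiv.refl ℝ F : F ≃L[ℝ] F) : F →L[ℝ] F) p := by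
    have h1 : HasStrictFDerivAt (fun q => r q - fderiv ℝ r p q) (0 : F →L[ℝ] ℝ) p := by
      have := hr.hasStrictFDerivAt.fun_sub (fderiv ℝ r p).hasStrictFDerivAt
      rwa [sub_self] at this
    have h2 := (hasStrictFDerivAt_id p).fun_add (h1.smul_const n)
    have h3 : ContinuousLinearMap.id ℝ F + ContinuousLinearMap.smulRight (0 : F →L[ℝ] ℝ) n
        = ((ContinuousLinearEquiv.refl ℝ F : F ≃L[ℝ] F) : F →L[ℝ] F) := by
      ext v
      simp
    rw [← h3]
    exact h2
  refine ⟨hψ.toOpenPartialHomeomorph ψ, hψ.mem_toOpenPartialHomeomorph_source, fun q => ?_,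
    hψ.to_localInverse⟩
  change fderiv ℝ r p (q + (r q - fderiv ℝ r p q) • n) = r q
  rw [map_add, map_smul, hn, smul_eq_mul, mul_one, add_sub_cancel]

/-- A function vanishing on a regular zero set `r = 0` is locally bounded by a multiple of `r`. -/
theorem exists_le_mul_of_vanishing {r g : F → ℝ} {p : F} (hr : AnalyticAt ℝ r p)
    (hr0 : fderiv ℝ r p ≠ 0) (hrp : r p = 0) (hg : AnalyticAt ℝ g p)
    (h : ∀ᶠ q in 𝓝 p, r q = 0 → g q = 0) : ∃ C, ∀ᶠ q in 𝓝 p, ‖g q‖ ≤ C * ‖r q‖ := by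
  obtain ⟨Ψ, hp, hΨ, hΨ'⟩ := exists_straightening hr hr0
  obtain ⟨n, hn⟩ : ∃ n, fderiv ℝ r p n = 1 := by
    obtain ⟨v, hv⟩ := DFunLike.exists_ne hr0
    refine ⟨(fderiv ℝ r p v)⁻¹ • v, ?_⟩
    rw [map_smul, smul_eq_mul]
    exact inv_mul_cancel₀ hv
  have hsymm : Ψ.symm (Ψ p) = p := Ψ.left_inv hp
  have hcomp : HasStrictFDerivAt (g ∘ Ψ.symm)
      ((fderiv ℝ g p).comp (ContinuousLinearMap.id ℝ F)) (Ψ p) :=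
    HasStrictFDerivAt.comp (g := g) (Ψ p) (by rw [hsymm]; exact hg.hasStrictFDerivAt) hΨ'
  obtain ⟨K, s, hs, hK⟩ := hcomp.exists_lipschitzOnWith
  have hc1 : Tendsto Ψ (𝓝 p) (𝓝 (Ψ p)) := (Ψ.continuousAt hp)
  have hc2 : Tendsto (fun q => Ψ q - r q • n) (𝓝 p) (𝓝 (Ψ p)) := by
    have : Tendsto (fun q => Ψ q - r q • n) (𝓝 p) (𝓝 (Ψ p - r p • n)) :=
      hc1.sub (hr.continuousAt.tendsto.smul_const n)
    simpa [hrp] using this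
  have hc3 : Tendsto Ψ.symm (𝓝 (Ψ p)) (𝓝 p) := by
    have := Ψ.symm.continuousAt (Ψ.map_source hp)
    rwa [ContinuousAt, hsymm] at this
  refine ⟨K * ‖n‖, ?_⟩
  filter_upwards [hc1.eventually hs, hc2.eventually hs, (hc3.comp hc2).eventually h,
    Ψ.open_source.mem_nhds hp, hc2.eventually (Ψ.open_target.mem_nhds (Ψ.map_source hp))]
    with q h1 h2 h3 h4 h5
  -- In straightened coordinates, moving by -r(q)n reaches the zero set. There g vanishes, and its
  -- Lipschitz bound over the distance |r(q)|‖n‖ is the claim.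
  have hz : r (Ψ.symm (Ψ q - r q • n)) = 0 := by
    rw [← hΨ, Ψ.right_inv h5, map_sub, map_smul, hn, hΨ]
    simp
  have hg0 := h3 hz
  have := hK.dist_le_mul _ h1 _ h2
  simp only [Function.comp_apply] at this hg0
  rw [hg0, Ψ.left_inv h4, dist_zero_right, dist_eq_norm, sub_sub_cancel, norm_smul] at this
  calc ‖g q‖ ≤ K * (‖r q‖ * ‖n‖) := this
    _ = K * ‖n‖ * ‖r q‖ := by ring

end Straightening

/-! ### Imaginary invariance implies being a tube -/

section Tube

/-- Componentwise real part. -/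
noncomputable def rePart : (Fin 3 → ℂ) →L[ℝ] (Fin 3 → ℝ) :=
  ContinuousLinearMap.pi fun k => Complex.reCLM.comp (ContinuousLinearMap.proj k)

/-- Componentwise imaginary part. -/
noncomputable def imPart : (Fin 3 → ℂ) →L[ℝ] (Fin 3 → ℝ) :=
  ContinuousLinearMap.pi fun k => Complex.imCLM.comp (ContinuousLinearMap.proj k)

/-- The inclusion of `ℝ³` in `ℂ³`. -/
noncomputable def ofRealPi : (Fin 3 → ℝ) →L[ℝ] (Fin 3 → ℂ) :=
  ContinuousLinearMap.pi fun k => Complex.ofRealCLM.comp (ContinuousLinearMap.proj k)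

@[simp] theorem rePart_apply (z : Fin 3 → ℂ) (k : Fin 3) : rePart z k = (z k).re := rfl

@[simp] theorem imPart_apply (z : Fin 3 → ℂ) (k : Fin 3) : imPart z k = (z k).im := rfl

@[simp] theorem ofRealPi_apply (x : Fin 3 → ℝ) (k : Fin 3) : ofRealPi x k = (x k : ℂ) := rfl

@[simp] theorem rePart_ofRealPi (x : Fin 3 → ℝ) : rePart (ofRealPi x) = x := by ext k; simp

@[simp] theorem imPart_ofRealPi (x : Fin 3 → ℝ) : imPart (ofRealPi x) = 0 := by ext k; simp

@[simp] theorem rePart_I_smul (z : Fin 3 → ℂ) : rePart (Complex.I • z) = -imPart z := by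
  ext k; simp

@[simp] theorem imPart_I_smul (z : Fin 3 → ℂ) : imPart (Complex.I • z) = rePart z := by
  ext k; simp

theorem ofRealPi_rePart_add (z : Fin 3 → ℂ) :
    ofRealPi (rePart z) + Complex.I • ofRealPi (imPart z) = z := by
  ext k
  simp [mul_comm Complex.I, Complex.re_add_im]

/-- If all imaginary directions are tangent to a regular zero set, then it is a tube near the base
point. -/
theorem eventually_eq_zero_iff_of_imaginary_tangent {r : (Fin 3 → ℂ) → ℝ} {z₀ : Fin 3 → ℂ}
    (hr : AnalyticAt ℝ r z₀) (hr0 : fderiv ℝ r z₀ ≠ 0) (hrz : r z₀ = 0)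
    (h : ∀ᶠ z in 𝓝 z₀, r z = 0 → ∀ j, fderiv ℝ r z (Pi.single j Complex.I) = 0) :
    ∀ᶠ z in 𝓝 z₀,
      (r z = 0 ↔ r (ofRealPi (rePart z) + Complex.I • ofRealPi (imPart z₀)) = 0) := by
  have hg : ∀ j : Fin 3, AnalyticAt ℝ (fun z => fderiv ℝ r z (Pi.single j Complex.I)) z₀ := by
    intro j
    have : ContDiffAt ℝ ⊤ (fun z => fderiv ℝ r z (Pi.single j Complex.I)) z₀ :=
      hr.fderiv.contDiffAt.clm_apply contDiffAt_const
    exact this.analyticAt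
  choose C hC using fun j => exists_le_mul_of_vanishing hr hr0 hrz (hg j)
    (h.mono fun z hz h0 => hz h0 j)
  obtain ⟨ε, hε, hball⟩ :=
    Metric.eventually_nhds_iff_ball.1 ((eventually_all.2 hC).and hr.eventually_analyticAt)
  filter_upwards [Metric.ball_mem_nhds z₀ hε] with z hz
  set w := ofRealPi (rePart z) + Complex.I • ofRealPi (imPart z₀) with hw
  have hwb : w ∈ Metric.ball z₀ ε := by
    rw [Metric.mem_ball, dist_eq_norm] at hz ⊢
    refine lt_of_le_of_lt ((pi_norm_le_iff_of_nonneg (norm_nonneg _)).2 fun k => ?_) hz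
    have h1 : (w - z₀) k = (((z - z₀) k).re : ℂ) := by
      apply Complex.ext <;> simp [hw]
    rw [h1, Complex.norm_real]
    exact (Complex.abs_re_le_norm _).trans (norm_le_pi_norm (z - z₀) k)
  -- On a segment in an imaginary direction the derivative of r is at most a constant times |r|, so
  -- Grönwall propagates r = 0. It is used in both directions between z and w.
  have hseg : ∀ a b : Fin 3 → ℂ, a ∈ Metric.ball z₀ ε → b ∈ Metric.ball z₀ ε →
      rePart (b - a) = 0 → r a = 0 → r b = 0 := by
    intro a b ha hb hab ha0
    have hsub := (convex_ball z₀ ε).segment_subset ha hb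
    refine eq_zero_of_segment (K := ∑ j, ‖(b - a) j‖ * C j)
      (fun q hq => (hball q (hsub hq)).2.differentiableAt) (fun q hq => ?_) ha0
    have hba : b - a = ∑ j, ((b - a) j).im • (Pi.single j Complex.I : Fin 3 → ℂ) := by
      ext i
      have := congrFun hab i
      simp only [rePart_apply, Pi.zero_apply] at this
      rw [Finset.sum_apply]
      simp only [Pi.smul_apply, Pi.single_apply, Complex.real_smul, mul_ite, mul_zero,
        Finset.sum_ite_eq, Finset.mem_univ, if_true]
      apply Complex.ext
      · simpa using this
      · simp
    have hlin : fderiv ℝ r q (b - a)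
        = ∑ j, ((b - a) j).im * fderiv ℝ r q (Pi.single j Complex.I) := by
      conv_lhs => rw [hba]
      simp [map_sum]
    rw [hlin, Finset.sum_mul]
    refine (norm_sum_le _ _).trans (Finset.sum_le_sum fun j _ => ?_)
    rw [norm_mul, mul_assoc]
    exact mul_le_mul (Complex.abs_im_le_norm _) ((hball q (hsub hq)).1 j) (norm_nonneg _)
      (norm_nonneg _)
  have hre : rePart w = rePart z := by
    simp [hw, map_add]
  exact ⟨hseg z w hz hwb (by rw [map_sub, hre, sub_self]),
    hseg w z hwb hz (by rw [map_sub, hre, sub_self])⟩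

end Tube

/-! ### Tube charts from totally real commuting symmetries -/

section TubeChart

open HolVectorField

variable {M : Set (Fin 3 → ℂ)} {p : Fin 3 → ℂ} {r : (Fin 3 → ℂ) → ℝ}

/-- Holomorphic coordinates `Φ` centred at `p` in which the vector fields `f j` are the constant
fields `i ∂/∂z_j` and `M` is the tube over the zero set of `ρ`. -/
structure IsTubeChart (M : Set (Fin 3 → ℂ)) (p : Fin 3 → ℂ) (f : Fin 3 → HolVectorField p)
    (Φ : OpenPartialHomeomorph (Fin 3 → ℂ) (Fin 3 → ℂ)) (ρ : (Fin 3 → ℝ) → ℝ) : Prop where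
  mem_source : p ∈ Φ.source
  map_base : Φ p = 0
  analyticAt : ∀ q ∈ Φ.source, AnalyticAt ℂ Φ q
  analyticAt_symm : ∀ z ∈ Φ.target, AnalyticAt ℂ Φ.symm z
  fderiv_rep : ∀ q ∈ Φ.source, ∀ j, fderiv ℂ Φ q (rep (f j) q) = Pi.single j Complex.I
  analyticAt_base : AnalyticAt ℝ ρ 0
  fderiv_base : fderiv ℝ ρ 0 ≠ 0
  mem_iff : ∀ᶠ q in 𝓝 p, (q ∈ M ↔ ρ (rePart (Φ q)) = 0)

theorem fderiv_symm_apply_fderiv {Φ : OpenPartialHomeomorph (Fin 3 → ℂ) (Fin 3 → ℂ)}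
    (h1 : ∀ q ∈ Φ.source, AnalyticAt ℂ Φ q) (h2 : ∀ z ∈ Φ.target, AnalyticAt ℂ Φ.symm z)
    {q : Fin 3 → ℂ} (hq : q ∈ Φ.source) (v : Fin 3 → ℂ) :
    fderiv ℂ Φ.symm (Φ q) (fderiv ℂ Φ q v) = v := by
  have hc := (h2 _ (Φ.map_source hq)).differentiableAt.hasFDerivAt.comp q
    (h1 q hq).differentiableAt.hasFDerivAt
  have hid : HasFDerivAt (Φ.symm ∘ Φ) (ContinuousLinearMap.id ℂ (Fin 3 → ℂ)) q := by
    refine (hasFDerivAt_id q).congr_of_eventuallyEq ?_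
    filter_upwards [Φ.open_source.mem_nhds hq] with x hx using Φ.left_inv hx
  exact congrArg (fun l => l v) (hc.unique hid)

theorem fderiv_apply_fderiv_symm {Φ : OpenPartialHomeomorph (Fin 3 → ℂ) (Fin 3 → ℂ)}
    (h1 : ∀ q ∈ Φ.source, AnalyticAt ℂ Φ q) (h2 : ∀ z ∈ Φ.target, AnalyticAt ℂ Φ.symm z)
    {q : Fin 3 → ℂ} (hq : q ∈ Φ.source) (v : Fin 3 → ℂ) :
    fderiv ℂ Φ q (fderiv ℂ Φ.symm (Φ q) v) = v := by
  have := fderiv_symm_apply_fderiv (Φ := Φ.symm) h2 h1 (Φ.map_source hq) v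
  simpa [Φ.left_inv hq] using this

theorem I_smul_ofRealPi (y : Fin 3 → ℝ) :
    Complex.I • ofRealPi y = ∑ j, y j • (Pi.single j Complex.I : Fin 3 → ℂ) := by
  ext i
  simp [Finset.sum_apply, Pi.single_apply, mul_comm]

/-- Three real-independent fields of a space `A` are complex-independent at `p` if no nonzero field
of `A` vanishes at `p` or has its `i`-multiple at `p` among the values of `A`. -/
theorem linearIndependent_val {A : Submodule ℝ (HolVectorField p)} {f : Fin 3 → HolVectorField p}
    (hfA : ∀ j, f j ∈ A) (hf : LinearIndependent ℝ f)
    (hval : ∀ g ∈ A, val g = 0 → g = 0)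
    (hnull : ∀ U ∈ A, ∀ V ∈ A, val V = Complex.I • val U → val U = 0) :
    LinearIndependent ℂ fun j => val (f j) := by
  rw [Fintype.linearIndependent_iff] at hf ⊢
  intro c hc
  have hmem : ∀ a : Fin 3 → ℝ, ∑ j, a j • f j ∈ A := fun a =>
    Submodule.sum_mem _ fun j _ => A.smul_mem _ (hfA j)
  have hsum : ∀ a : Fin 3 → ℝ, val (∑ j, a j • f j) = ∑ j, (a j : ℂ) • val (f j) := fun a => by
    simp only [map_sum, real_smul_eq, map_smul]
  -- Splitting the coefficients of a complex relation into real and imaginary parts produces a null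
  -- pair in A.
  have h1 : val (∑ j, (c j).re • f j) = Complex.I • val (∑ j, (-(c j).im) • f j) := by
    rw [hsum, hsum, Finset.smul_sum, ← sub_eq_zero, ← Finset.sum_sub_distrib, ← hc]
    refine Finset.sum_congr rfl fun j _ => ?_
    rw [smul_smul, ← sub_smul]
    congr 1
    conv_rhs => rw [← Complex.re_add_im (c j)]
    push_cast
    ring
  have h2 := hnull _ (hmem _) _ (hmem _) h1
  have h3 := hval _ (hmem _) h2
  have h4 := hval _ (hmem _) (by rw [h1, h2, smul_zero])
  intro j
  exact Complex.ext (hf _ h4 j) (neg_eq_zero.1 (hf _ h3 j))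

/-- A hypersurface with three commuting, totally real independent infinitesimal symmetries is a
tube. -/
theorem exists_isTubeChart (hr : IsLocalDefiningFunction M p r) (hp : p ∈ M)
    {f : Fin 3 → HolVectorField p} (hf : ∀ j, f j ∈ hol M p) (hcomm : ∀ i j, ⁅f i, f j⁆ = 0)
    (hli : LinearIndependent ℂ fun j => val (f j)) : ∃ Φ ρ, IsTubeChart M p f Φ ρ := by
  obtain ⟨Φ₀, hp₀, ha₀, hs₀, hd₀⟩ := exists_rectifying_coordinates hcomm hli
  obtain ⟨Φ, hpΦ, hΦp, ha, hs, hd⟩ : ∃ Φ : OpenPartialHomeomorph (Fin 3 → ℂ) (Fin 3 → ℂ),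
      p ∈ Φ.source ∧ Φ p = 0 ∧ (∀ q ∈ Φ.source, AnalyticAt ℂ Φ q) ∧
      (∀ z ∈ Φ.target, AnalyticAt ℂ Φ.symm z) ∧
      ∀ q ∈ Φ.source, ∀ j, fderiv ℂ Φ q (rep (f j) q) = Pi.single j Complex.I := by
    have hcoe : ∀ q, Φ₀.transHomeomorph (Homeomorph.addRight (-Φ₀ p)) q = Φ₀ q + -Φ₀ p :=
      fun q => rfl
    have hcoes : ∀ z, (Φ₀.transHomeomorph (Homeomorph.addRight (-Φ₀ p))).symm z
        = Φ₀.symm (z + Φ₀ p) := fun z => by simp [Homeomorph.addRight_symm]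
    refine ⟨Φ₀.transHomeomorph (Homeomorph.addRight (-Φ₀ p)), hp₀, ?_, fun q hq => ?_,
      fun z hz => ?_, fun q hq j => ?_⟩
    · rw [hcoe, add_neg_cancel]
    · rw [show (Φ₀.transHomeomorph (Homeomorph.addRight (-Φ₀ p)) : (Fin 3 → ℂ) → (Fin 3 → ℂ))
        = fun q => Φ₀ q + -Φ₀ p from rfl]
      exact (ha₀ q hq).fun_add analyticAt_const
    · rw [show ((Φ₀.transHomeomorph (Homeomorph.addRight (-Φ₀ p))).symm
        : (Fin 3 → ℂ) → (Fin 3 → ℂ)) = fun z => Φ₀.symm (z + Φ₀ p) from funext hcoes]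
      have hz' : z + Φ₀ p ∈ Φ₀.target := by
        simpa [Homeomorph.addRight_symm] using hz
      exact AnalyticAt.fun_comp (g := Φ₀.symm) (f := fun z => z + Φ₀ p) (hs₀ _ hz')
        (analyticAt_id.fun_add analyticAt_const)
    · rw [show (Φ₀.transHomeomorph (Homeomorph.addRight (-Φ₀ p)) : (Fin 3 → ℂ) → (Fin 3 → ℂ))
        = fun q => Φ₀ q + -Φ₀ p from rfl, fderiv_add_const]
      exact hd₀ q hq j
  have h0t : (0 : Fin 3 → ℂ) ∈ Φ.target := hΦp ▸ Φ.map_source hpΦ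
  have hs0 : Φ.symm 0 = p := by rw [← hΦp, Φ.left_inv hpΦ]
  have hcont : Tendsto Φ.symm (𝓝 0) (𝓝 p) := by
    have := (hs 0 h0t).continuousAt.tendsto
    rwa [hs0] at this
  have hcontΦ : Tendsto Φ (𝓝 p) (𝓝 0) := by
    have := (ha p hpΦ).continuousAt.tendsto
    rwa [hΦp] at this
  let R : (Fin 3 → ℂ) → ℝ := fun z => r (Φ.symm z)
  have hR : AnalyticAt ℝ R 0 :=
    AnalyticAt.fun_comp (g := r) (by rw [hs0]; exact hr.1) (hs 0 h0t).restrictScalars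
  have hder : ∀ᶠ q in 𝓝 p, ∀ v, fderiv ℝ R (Φ q) (fderiv ℂ Φ q v) = fderiv ℝ r q v := by
    filter_upwards [hr.1.eventually_analyticAt, Φ.open_source.mem_nhds hpΦ] with q h1 h2 v
    have h3 : HasFDerivAt R _ (Φ q) :=
      HasFDerivAt.comp (g := r) (Φ q) (by
        rw [Φ.left_inv h2]; exact h1.differentiableAt.hasFDerivAt)
        ((hs _ (Φ.map_source h2)).differentiableAt.hasFDerivAt.restrictScalars ℝ)
    rw [h3.fderiv]
    change fderiv ℝ r q (fderiv ℂ Φ.symm (Φ q) (fderiv ℂ Φ q v)) = _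
    rw [fderiv_symm_apply_fderiv ha hs h2]
  have hR0 : fderiv ℝ R 0 ≠ 0 := by
    intro h
    refine hr.2.1 (ContinuousLinearMap.ext fun v => ?_)
    rw [← hder.self_of_nhds v, hΦp, h]
    rfl
  have hRz : R 0 = 0 := by
    change r (Φ.symm 0) = 0
    rw [hs0]
    exact hr.2.2.self_of_nhds.1 hp
  have htan : ∀ᶠ z in 𝓝 (0 : Fin 3 → ℂ), R z = 0 →
      ∀ j, fderiv ℝ R z (Pi.single j Complex.I) = 0 := by
    have hf' : ∀ᶠ q in 𝓝 p, ∀ j, q ∈ M → fderiv ℝ r q (rep (f j) q) = 0 :=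
      eventually_all.2 fun j => (mem_hol_iff hr EventuallyEq.rfl).1 (hf j)
    filter_upwards [hcont.eventually (hf'.and (hr.2.2.and hder)), Φ.open_target.mem_nhds h0t]
      with z ⟨h1, h2, h3⟩ hz hRz j
    have h4 := h3 (rep (f j) (Φ.symm z))
    rwa [h1 j (h2.2 hRz), hd _ (Φ.map_target hz), Φ.right_inv hz] at h4
  have htube := eventually_eq_zero_iff_of_imaginary_tangent hR hR0 hRz htan
  simp only [map_zero, smul_zero, add_zero] at htube
  have hR0' : AnalyticAt ℝ R (ofRealPi 0) := by rw [map_zero]; exact hR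
  refine ⟨Φ, fun x => R (ofRealPi x), hpΦ, hΦp, ha, hs, hd,
    hR0'.fun_comp (ofRealPi.analyticAt 0), fun h => hR0 ?_, ?_⟩
  · have h1 : HasFDerivAt (fun x => R (ofRealPi x)) ((fderiv ℝ R (ofRealPi 0)).comp ofRealPi) 0 :=
      hR0'.differentiableAt.hasFDerivAt.comp 0 ofRealPi.hasFDerivAt
    rw [h1.fderiv, map_zero] at h
    refine ContinuousLinearMap.ext fun v => ?_
    have h2 : fderiv ℝ R 0 (ofRealPi (rePart v)) = 0 :=
      congrArg (fun l => l (rePart v)) h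
    rw [← ofRealPi_rePart_add v, map_add, h2, I_smul_ofRealPi, map_sum]
    simp only [map_smul, htan.self_of_nhds hRz]
    simp
  · filter_upwards [hr.2.2, hcontΦ.eventually htube, Φ.open_source.mem_nhds hpΦ] with q h1 h2 h3
    rw [h1, ← h2]
    change _ ↔ r (Φ.symm (Φ q)) = 0
    rw [Φ.left_inv h3]

end TubeChart

/-! ### Complexified affine vector fields -/

section Complexification

/-- The complex affine vector field with real linear part `A` and constant term `A 0 + i c`. -/
noncomputable def complexify (A : (Fin 3 → ℝ) →ᵃ[ℝ] (Fin 3 → ℝ)) (c : Fin 3 → ℝ) :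
    (Fin 3 → ℂ) → (Fin 3 → ℂ) := fun z i =>
  ∑ j, (A.linear (Pi.single j 1) i : ℂ) * z j + (A 0 i + Complex.I * c i)

theorem affine_apply_eq_sum (A : (Fin 3 → ℝ) →ᵃ[ℝ] (Fin 3 → ℝ)) (x : Fin 3 → ℝ) (i : Fin 3) :
    A x i = ∑ j, A.linear (Pi.single j 1) i * x j + A 0 i := by
  have h1 : A x = A.linear x + A 0 := by
    have := A.map_vadd 0 x
    simpa using this
  have h2 : A.linear x = ∑ j, x j • A.linear (Pi.single j 1) := by
    conv_lhs => rw [pi_eq_sum_univ' x]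
    simp [map_sum]
  rw [h1, h2]
  simp [Finset.sum_apply, mul_comm]

theorem rePart_complexify (A : (Fin 3 → ℝ) →ᵃ[ℝ] (Fin 3 → ℝ)) (c : Fin 3 → ℝ) (z : Fin 3 → ℂ) :
    rePart (complexify A c z) = A (rePart z) := by
  ext i
  rw [affine_apply_eq_sum]
  simp [complexify, Complex.re_sum]

theorem complexify_zero_eq (A : (Fin 3 → ℝ) →ᵃ[ℝ] (Fin 3 → ℝ)) (c : Fin 3 → ℝ) :
    complexify A c 0 = ofRealPi (A 0) + Complex.I • ofRealPi c := by
  ext i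
  simp [complexify]

theorem complexify_zero_eq_zero_iff {A : (Fin 3 → ℝ) →ᵃ[ℝ] (Fin 3 → ℝ)} {c : Fin 3 → ℝ} :
    complexify A c 0 = 0 ↔ A 0 = 0 ∧ c = 0 := by
  rw [complexify_zero_eq]
  refine ⟨fun h => ⟨?_, ?_⟩, fun ⟨h1, h2⟩ => by simp [h1, h2]⟩
  · simpa using congrArg rePart h
  · simpa using congrArg imPart h

theorem complexify_add (A B : (Fin 3 → ℝ) →ᵃ[ℝ] (Fin 3 → ℝ)) (c d : Fin 3 → ℝ) (z : Fin 3 → ℂ) :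
    complexify (A + B) (c + d) z = complexify A c z + complexify B d z := by
  ext i
  simp only [complexify, AffineMap.add_linear, LinearMap.add_apply, Pi.add_apply,
    Complex.ofReal_add, add_mul, Finset.sum_add_distrib, AffineMap.coe_add]
  ring

theorem complexify_smul (a : ℝ) (A : (Fin 3 → ℝ) →ᵃ[ℝ] (Fin 3 → ℝ)) (c : Fin 3 → ℝ)
    (z : Fin 3 → ℂ) : complexify (a • A) (a • c) z = (a : ℂ) • complexify A c z := by
  ext i
  simp only [complexify, AffineMap.smul_linear, LinearMap.smul_apply, Pi.smul_apply, smul_eq_mul,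
    Complex.ofReal_mul, mul_add, Finset.mul_sum, AffineMap.coe_smul]
  simp only [mul_assoc, mul_left_comm (Complex.I)]

theorem hasFDerivAt_complexify (A : (Fin 3 → ℝ) →ᵃ[ℝ] (Fin 3 → ℝ)) (c : Fin 3 → ℝ)
    (z : Fin 3 → ℂ) : HasFDerivAt (complexify A c)
      (ContinuousLinearMap.pi fun i => ∑ j, (A.linear (Pi.single j 1) i : ℂ) •
        ContinuousLinearMap.proj (R := ℂ) (φ := fun _ : Fin 3 => ℂ) j) z := by
  rw [hasFDerivAt_pi]
  intro i
  refine HasFDerivAt.add_const _ ?_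
  refine HasFDerivAt.fun_sum fun j _ => ?_
  exact (ContinuousLinearMap.proj (R := ℂ) (φ := fun _ : Fin 3 => ℂ) j).hasFDerivAt.const_mul _

theorem analyticAt_complexify (A : (Fin 3 → ℝ) →ᵃ[ℝ] (Fin 3 → ℝ)) (c : Fin 3 → ℝ)
    (z : Fin 3 → ℂ) : AnalyticAt ℂ (complexify A c) z := by
  rw [show complexify A c = fun z i => complexify A c z i from rfl, analyticAt_pi_iff]
  intro i
  refine AnalyticAt.fun_add (Finset.analyticAt_fun_sum _ fun j _ => ?_) analyticAt_const
  exact analyticAt_const.fun_mul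
    ((ContinuousLinearMap.proj (R := ℂ) (φ := fun _ : Fin 3 => ℂ) j).analyticAt z)

theorem affine_eq_zero_of_eventually {A : (Fin 3 → ℝ) →ᵃ[ℝ] (Fin 3 → ℝ)}
    (h : ∀ᶠ x in 𝓝 0, A x = 0) : A = 0 := by
  have h1 : ∀ x, A x = A.linear x := fun x => by
    have := A.map_vadd 0 x
    simpa [h.self_of_nhds] using this
  let L := LinearMap.toContinuousLinearMap A.linear
  have h2 : L =ᶠ[𝓝 0] fun _ => (0 : Fin 3 → ℝ) := by
    filter_upwards [h] with x hx
    rw [← hx, h1]; rfl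
  have h3 : L = 0 := by
    rw [← L.fderiv (x := 0), h2.fderiv_eq, fderiv_fun_const]
    rfl
  refine AffineMap.ext fun x => ?_
  rw [h1]
  exact congrArg (fun l => l x) h3

end Complexification

/-! ### Symmetries are affine in a tube chart -/

section AffineSymmetries

open HolVectorField

variable {M : Set (Fin 3 → ℂ)} {p : Fin 3 → ℂ} {f : Fin 3 → HolVectorField p}
  {Φ : OpenPartialHomeomorph (Fin 3 → ℂ) (Fin 3 → ℂ)} {ρ : (Fin 3 → ℝ) → ℝ}

theorem analyticAt_clm_apply {L : (Fin 3 → ℂ) → (Fin 3 → ℂ) →L[ℂ] (Fin 3 → ℂ)}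
    {X : (Fin 3 → ℂ) → (Fin 3 → ℂ)} (hL : AnalyticAt ℂ L p) (hX : AnalyticAt ℂ X p) :
    AnalyticAt ℂ (fun q => L q (X q)) p :=
  ContDiffAt.analyticAt (ContDiffAt.clm_apply hL.contDiffAt hX.contDiffAt)

/-- The affine vector fields tangent to the zero set of `ρ` near the origin. -/
def affSymmetriesNear (ρ : (Fin 3 → ℝ) → ℝ) :
    Submodule ℝ ((Fin 3 → ℝ) →ᵃ[ℝ] (Fin 3 → ℝ)) where
  carrier := {A | ∀ᶠ x in 𝓝 0, ρ x = 0 → fderiv ℝ ρ x (A x) = 0}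
  add_mem' := fun {A B} hA hB => by
    filter_upwards [hA, hB] with x h1 h2 hx
    rw [AffineMap.coe_add, Pi.add_apply, map_add, h1 hx, h2 hx, add_zero]
  zero_mem' := Eventually.of_forall fun x _ => map_zero _
  smul_mem' := fun c A hA => by
    filter_upwards [hA] with x h1 hx
    rw [AffineMap.coe_smul, Pi.smul_apply, map_smul, h1 hx, smul_zero]

namespace IsTubeChart

theorem tendsto (hT : IsTubeChart M p f Φ ρ) : Tendsto Φ (𝓝 p) (𝓝 0) := by
  have := (hT.analyticAt p hT.mem_source).continuousAt.tendsto
  rwa [hT.map_base] at this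

theorem zero_mem_target (hT : IsTubeChart M p f Φ ρ) : (0 : Fin 3 → ℂ) ∈ Φ.target :=
  hT.map_base ▸ Φ.map_source hT.mem_source

theorem symm_zero (hT : IsTubeChart M p f Φ ρ) : Φ.symm 0 = p := by
  rw [← hT.map_base, Φ.left_inv hT.mem_source]

theorem tendsto_symm (hT : IsTubeChart M p f Φ ρ) : Tendsto Φ.symm (𝓝 0) (𝓝 p) := by
  have := (hT.analyticAt_symm 0 hT.zero_mem_target).continuousAt.tendsto
  rwa [hT.symm_zero] at this

theorem tendsto_rePart (hT : IsTubeChart M p f Φ ρ) :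
    Tendsto (fun q => rePart (Φ q)) (𝓝 p) (𝓝 0) := by
  have h : Tendsto rePart (𝓝 (0 : Fin 3 → ℂ)) (𝓝 0) := by
    simpa using rePart.continuous.tendsto 0
  exact h.comp hT.tendsto

theorem tendsto_symm_ofRealPi (hT : IsTubeChart M p f Φ ρ) :
    Tendsto (fun x => Φ.symm (ofRealPi x)) (𝓝 0) (𝓝 p) := by
  have h : Tendsto ofRealPi (𝓝 (0 : Fin 3 → ℝ)) (𝓝 0) := by
    simpa using ofRealPi.continuous.tendsto 0
  exact hT.tendsto_symm.comp h

theorem fderiv_tube (hT : IsTubeChart M p f Φ ρ) : ∀ᶠ q in 𝓝 p, ∀ v,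
    fderiv ℝ (fun q => ρ (rePart (Φ q))) q v
      = fderiv ℝ ρ (rePart (Φ q)) (rePart (fderiv ℂ Φ q v)) := by
  filter_upwards [hT.tendsto_rePart.eventually hT.analyticAt_base.eventually_analyticAt,
    Φ.open_source.mem_nhds hT.mem_source] with q h1 h2 v
  have h3 : HasFDerivAt (fun q => rePart (Φ q))
      (rePart.comp ((fderiv ℂ Φ q).restrictScalars ℝ)) q :=
    rePart.hasFDerivAt.comp q
      ((hT.analyticAt q h2).differentiableAt.hasFDerivAt.restrictScalars ℝ)
  have h4 : HasFDerivAt (fun q => ρ (rePart (Φ q))) _ q :=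
    h1.differentiableAt.hasFDerivAt.comp q h3
  rw [h4.fderiv]
  rfl

theorem isLocalDefiningFunction (hT : IsTubeChart M p f Φ ρ) :
    IsLocalDefiningFunction M p fun q => ρ (rePart (Φ q)) := by
  have hp := hT.mem_source
  refine ⟨?_, fun h => hT.fderiv_base (ContinuousLinearMap.ext fun x => ?_), hT.mem_iff⟩
  · have h1 : AnalyticAt ℝ (fun q => rePart (Φ q)) p :=
      (rePart.analyticAt _).fun_comp (hT.analyticAt p hp).restrictScalars
    refine AnalyticAt.fun_comp (g := ρ) ?_ h1
    rw [hT.map_base, map_zero]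
    exact hT.analyticAt_base
  · have h1 := hT.fderiv_tube.self_of_nhds (fderiv ℂ Φ.symm (Φ p) (ofRealPi x))
    rw [fderiv_apply_fderiv_symm hT.analyticAt hT.analyticAt_symm hp, h, hT.map_base,
      map_zero, rePart_ofRealPi] at h1
    exact h1.symm

/-- The symmetries of `ℂ³` that are affine with real linear part in a tube chart. -/
noncomputable def affineField (hT : IsTubeChart M p f Φ ρ) :
    (((Fin 3 → ℝ) →ᵃ[ℝ] (Fin 3 → ℝ)) × (Fin 3 → ℝ)) →ₗ[ℝ] HolVectorField p where
  toFun a := ofAnalytic (fun q => fderiv ℂ Φ.symm (Φ q) (complexify a.1 a.2 (Φ q))) (by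
    have h1 : AnalyticAt ℂ (fderiv ℂ Φ.symm) (Φ p) :=
      (hT.analyticAt_symm _ (Φ.map_source hT.mem_source)).fderiv
    have h2 := hT.analyticAt p hT.mem_source
    exact analyticAt_clm_apply (h1.fun_comp h2) ((analyticAt_complexify _ _ _).fun_comp h2))
  map_add' a b := Subtype.ext <| Germ.coe_eq.2 <| Eventually.of_forall fun q => by
    change _ = fderiv ℂ Φ.symm (Φ q) _ + fderiv ℂ Φ.symm (Φ q) _
    rw [← map_add, ← complexify_add]
    rfl
  map_smul' c a := Subtype.ext <| Germ.coe_eq.2 <| Eventually.of_forall fun q => by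
    change _ = (c : ℂ) • fderiv ℂ Φ.symm (Φ q) _
    rw [← map_smul, ← complexify_smul]
    rfl

theorem rep_affineField (hT : IsTubeChart M p f Φ ρ)
    (a : ((Fin 3 → ℝ) →ᵃ[ℝ] (Fin 3 → ℝ)) × (Fin 3 → ℝ)) :
    rep (hT.affineField a)
      =ᶠ[𝓝 p] fun q => fderiv ℂ Φ.symm (Φ q) (complexify a.1 a.2 (Φ q)) :=
  rep_eventuallyEq rfl

theorem fderiv_rep_affineField (hT : IsTubeChart M p f Φ ρ)
    (a : ((Fin 3 → ℝ) →ᵃ[ℝ] (Fin 3 → ℝ)) × (Fin 3 → ℝ)) :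
    ∀ᶠ q in 𝓝 p, fderiv ℂ Φ q (rep (hT.affineField a) q) = complexify a.1 a.2 (Φ q) := by
  filter_upwards [hT.rep_affineField a, Φ.open_source.mem_nhds hT.mem_source] with q h1 h2
  rw [h1, fderiv_apply_fderiv_symm hT.analyticAt hT.analyticAt_symm h2]

theorem val_affineField_eq_zero (hT : IsTubeChart M p f Φ ρ)
    {A : (Fin 3 → ℝ) →ᵃ[ℝ] (Fin 3 → ℝ)} (hA : A 0 = 0) : val (hT.affineField (A, 0)) = 0 := by
  rw [← rep_self, (hT.rep_affineField _).self_of_nhds]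
  beta_reduce
  rw [hT.map_base, complexify_zero_eq_zero_iff.2 ⟨hA, rfl⟩, map_zero]

theorem affineField_injective (hT : IsTubeChart M p f Φ ρ) :
    Function.Injective hT.affineField := by
  rw [injective_iff_map_eq_zero]
  rintro ⟨A, c⟩ h
  have h1 : ∀ᶠ q in 𝓝 p, complexify A c (Φ q) = 0 := by
    have h0 := rep_zero (p := p)
    rw [← h] at h0
    filter_upwards [hT.fderiv_rep_affineField (A, c), h0] with q h1 h2
    rw [← h1, h2, map_zero]
  have h2 := h1.self_of_nhds
  rw [hT.map_base] at h2
  have hA : A = 0 := by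
    refine affine_eq_zero_of_eventually ?_
    have h3 : Tendsto ofRealPi (𝓝 (0 : Fin 3 → ℝ)) (𝓝 0) := by
      simpa using ofRealPi.continuous.tendsto 0
    filter_upwards [hT.tendsto_symm_ofRealPi.eventually h1,
      h3.eventually (Φ.open_target.mem_nhds hT.zero_mem_target)] with x hx hxt
    rw [Φ.right_inv hxt] at hx
    have := rePart_complexify A c (ofRealPi x)
    rw [hx, map_zero, rePart_ofRealPi] at this
    exact this.symm
  rw [hA, (complexify_zero_eq_zero_iff.1 h2).2]
  rfl

/-- Tangency to a tube only involves the real part of a field, here A(Re z). The imaginary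
translation c is therefore unconstrained. -/
theorem affineField_mem_hol_iff (hT : IsTubeChart M p f Φ ρ)
    {A : (Fin 3 → ℝ) →ᵃ[ℝ] (Fin 3 → ℝ)} {c : Fin 3 → ℝ} :
    hT.affineField (A, c) ∈ hol M p ↔ A ∈ affSymmetriesNear ρ := by
  have h3 : Tendsto ofRealPi (𝓝 (0 : Fin 3 → ℝ)) (𝓝 0) := by
    simpa using ofRealPi.continuous.tendsto 0
  have key : ∀ᶠ q in 𝓝 p, fderiv ℝ (fun q => ρ (rePart (Φ q))) q (rep (hT.affineField (A, c)) q)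
      = fderiv ℝ ρ (rePart (Φ q)) (A (rePart (Φ q))) := by
    filter_upwards [hT.fderiv_tube, hT.fderiv_rep_affineField (A, c)] with q h1 h2
    rw [h1, h2, rePart_complexify]
  rw [mem_hol_iff hT.isLocalDefiningFunction EventuallyEq.rfl]
  constructor
  · intro h
    change ∀ᶠ x in 𝓝 0, ρ x = 0 → fderiv ℝ ρ x (A x) = 0
    filter_upwards [hT.tendsto_symm_ofRealPi.eventually (h.and (key.and hT.mem_iff)),
      h3.eventually (Φ.open_target.mem_nhds hT.zero_mem_target)] with x ⟨h1, h2, h4⟩ hxt hx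
    rw [Φ.right_inv hxt, rePart_ofRealPi] at h2 h4
    rw [← h2]
    exact h1 (h4.2 hx)
  · intro h
    filter_upwards [hT.tendsto_rePart.eventually h, key, hT.mem_iff] with q h1 h2 h4 hq
    rw [h2]
    exact h1 (h4.1 hq)

/-- In a tube chart every symmetry normalizing the translations `f` is affine. -/
theorem exists_affineField_eq (hT : IsTubeChart M p f Φ ρ)
    (hli : LinearIndependent ℂ fun j => val (f j)) {g : HolVectorField p}
    {c : Fin 3 → Fin 3 → ℝ} (hg : ∀ k, ⁅f k, g⁆ = ∑ j, c k j • f j) :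
    ∃ a, hT.affineField a = g := by
  have hp := hT.mem_source
  let G : (Fin 3 → ℂ) → (Fin 3 → ℂ) := fun q => fderiv ℂ Φ q (rep g q)
  have hG : AnalyticAt ℂ G p := analyticAt_clm_apply (hT.analyticAt p hp).fderiv (analyticAt_rep g)
  let A : (Fin 3 → ℝ) →ᵃ[ℝ] (Fin 3 → ℝ) :=
    (Matrix.toLin' (Matrix.of fun i j => c j i)).toAffineMap + AffineMap.const ℝ _ (rePart (G p))
  have hA0 : A 0 = rePart (G p) := by simp [A]
  have hAl : ∀ k i, A.linear (Pi.single k 1) i = c k i := by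
    intro k i
    simp [A]
  let d := imPart (G p)
  have hrep : ∀ k, rep ⁅f k, g⁆ =ᶠ[𝓝 p] fun q => ∑ j, (c k j : ℂ) • rep (f j) q := by
    intro k
    rw [hg k]
    simp only [Fin.sum_univ_three, real_smul_eq]
    filter_upwards [rep_add ((c k 0 : ℂ) • f 0 + (c k 1 : ℂ) • f 1) ((c k 2 : ℂ) • f 2),
      rep_add ((c k 0 : ℂ) • f 0) ((c k 1 : ℂ) • f 1), rep_smul (c k 0 : ℂ) (f 0),
      rep_smul (c k 1 : ℂ) (f 1), rep_smul (c k 2 : ℂ) (f 2)] with q h1 h2 h3 h4 h5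
    rw [h1, h2, h3, h4, h5]
  have hGd : ∀ᶠ q in 𝓝 p, ∀ k, fderiv ℂ G q (rep (f k) q)
      = ∑ j, (c k j : ℂ) • (Pi.single j Complex.I : Fin 3 → ℂ) := by
    rw [eventually_all]
    intro k
    filter_upwards [hrep k, rep_lie (f k) g, (Φ.open_source.eventually_mem hp).eventually_nhds,
      (analyticAt_rep g).eventually_analyticAt, (analyticAt_rep (f k)).eventually_analyticAt]
      with q h1 h2 h3 h4 h5
    have hq := h3.self_of_nhds
    -- Since dΦ(f_k) is constant, dΦ([f_k, g]) is just the derivative of G along f_k.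
    have h6 := VectorField.fderiv_apply_lieBracket (n := minSmoothness ℂ 2)
      (hT.analyticAt q hq).contDiffAt le_rfl h4.differentiableAt h5.differentiableAt
    have h7 : (fun x => fderiv ℂ Φ x (rep (f k) x)) =ᶠ[𝓝 q] fun _ => Pi.single k Complex.I := by
      filter_upwards [h3] with x hx using hT.fderiv_rep x hx k
    rw [h7.fderiv_eq, fderiv_fun_const, ← h2, h1, map_sum] at h6
    simp only [map_smul, hT.fderiv_rep q hq] at h6
    rw [h6]
    simp [G]
  -- The difference vanishes at p and has zero derivative along the frame:
  -- `eventually_eq_zero_of_frame` with eigenvalues 0.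
  have hzero : ∀ᶠ q in 𝓝 p, ∀ i, G q i - complexify A d (Φ q) i = 0 := by
    rw [eventually_all]
    intro i
    have hC : ∀ q ∈ Φ.source, AnalyticAt ℂ (fun q => complexify A d (Φ q)) q := fun q hq =>
      (analyticAt_complexify A d _).fun_comp (hT.analyticAt q hq)
    refine eventually_eq_zero_of_frame (F := fun j => rep (f j)) (fun j => analyticAt_rep _)
      (by simpa only [rep_self] using hli)
      (((ContinuousLinearMap.proj (R := ℂ) (φ := fun _ : Fin 3 => ℂ) i).analyticAt _).fun_comp
        (hG.fun_sub (hC p hp))) 0 ?_ ?_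
    · filter_upwards [hGd, hG.eventually_analyticAt, Φ.open_source.mem_nhds hp] with q h1 h2 hq k
      have h3 := (hasFDerivAt_complexify A d (Φ q)).comp q
        (hT.analyticAt q hq).differentiableAt.hasFDerivAt
      have h4 := (ContinuousLinearMap.proj (R := ℂ) (φ := fun _ : Fin 3 => ℂ) i).hasFDerivAt.comp q
        (h2.differentiableAt.hasFDerivAt.sub h3)
      have h5 := congrArg (fun l => l (rep (f k) q)) h4.fderiv
      refine h5.trans ?_
      simp [h1 k, hT.fderiv_rep q hq, hAl, Pi.single_apply]
    · rw [hT.map_base, complexify_zero_eq, hA0, ofRealPi_rePart_add, sub_self]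
  refine ⟨(A, d), ext_rep ?_⟩
  filter_upwards [hT.rep_affineField (A, d), hzero, Φ.open_source.mem_nhds hp] with q h1 h2 h3
  have h4 : complexify A d (Φ q) = G q := funext fun i => (sub_eq_zero.1 (h2 i)).symm
  rw [h1, h4, fderiv_symm_apply_fderiv hT.analyticAt hT.analyticAt_symm h3]

/-- Pairs of an affine symmetry of the base and an imaginary translation correspond bijectively to
symmetries of M, so the dimension is 5 - 3. -/
theorem finrank_affSymmetriesNear (hT : IsTubeChart M p f Φ ρ)
    (hst : IsHolSimplyTransitive M) (hp : p ∈ M)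
    (h : ∀ g ∈ hol M p, ∃ a, hT.affineField a = g) :
    Module.finrank ℝ (affSymmetriesNear ρ) = 2 := by
  have hdim := (hst p hp).2
  let T : (affSymmetriesNear ρ × (Fin 3 → ℝ)) →ₗ[ℝ] hol M p :=
    LinearMap.codRestrict (hol M p).toSubmodule
      (hT.affineField ∘ₗ (LinearMap.prodMap (affSymmetriesNear ρ).subtype LinearMap.id))
      fun a => hT.affineField_mem_hol_iff.2 a.1.2
  have hinj : Function.Injective T := by
    rintro ⟨⟨A, hA⟩, c⟩ ⟨⟨B, hB⟩, d⟩ hab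
    have := hT.affineField_injective (congrArg Subtype.val hab)
    simpa using this
  have hsurj : Function.Surjective T := by
    rintro ⟨g, hg⟩
    obtain ⟨⟨A, c⟩, rfl⟩ := h g hg
    exact ⟨(⟨A, hT.affineField_mem_hol_iff.1 hg⟩, c), rfl⟩
  have hfin : Module.Finite ℝ (hol M p) := Module.finite_of_finrank_pos (by omega)
  have hfin' : Module.Finite ℝ (affSymmetriesNear ρ) :=
    Module.Finite.of_injective (T ∘ₗ LinearMap.inl ℝ _ _) (hinj.comp LinearMap.inl_injective)
  have := (LinearEquiv.ofBijective T ⟨hinj, hsurj⟩).finrank_eq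
  rw [Module.finrank_prod, hdim] at this
  simp at this
  omega

theorem eq_zero_of_mem_affSymmetriesNear (hT : IsTubeChart M p f Φ ρ)
    (hst : IsHolSimplyTransitive M) (hp : p ∈ M) {A : (Fin 3 → ℝ) →ᵃ[ℝ] (Fin 3 → ℝ)}
    (hA : A ∈ affSymmetriesNear ρ) (h0 : A 0 = 0) : A = 0 := by
  have h1 := eq_zero_of_val_eq_zero hst hT.isLocalDefiningFunction hp
    (hT.affineField_mem_hol_iff.2 hA) (hT.val_affineField_eq_zero h0)
  exact congrArg Prod.fst (hT.affineField_injective (h1.trans (map_zero _).symm))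

end IsTubeChart

end AffineSymmetries

/-! ### The affinely simply-transitive base -/

section AffineSurface

/-- A regular zero set whose germ at the origin is affinely simply-transitive has an open piece that
is a connected affinely simply-transitive surface. -/
theorem exists_isAffSimplyTransitive {ρ : (Fin 3 → ℝ) → ℝ} (hρ : AnalyticAt ℝ ρ 0)
    (hρ0 : fderiv ℝ ρ 0 ≠ 0) (hρz : ρ 0 = 0)
    (hdim : Module.finrank ℝ (affSymmetriesNear ρ) = 2)
    (hev : ∀ A ∈ affSymmetriesNear ρ, A 0 = 0 → A = 0) :
    ∃ O : Set (Fin 3 → ℝ), IsOpen O ∧ 0 ∈ O ∧ IsConnected {x ∈ O | ρ x = 0} ∧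
      IsAnalyticHypersurface {x ∈ O | ρ x = 0} ∧ IsAffSimplyTransitive {x ∈ O | ρ x = 0} := by
  have hfin : Module.Finite ℝ (affSymmetriesNear ρ) := Module.finite_of_finrank_pos (by omega)
  let b := Module.finBasisOfFinrankEq ℝ (affSymmetriesNear ρ) hdim
  have hli0 : LinearIndependent ℝ fun i => (b i).1 0 := by
    let ev : affSymmetriesNear ρ →ₗ[ℝ] (Fin 3 → ℝ) :=
      { toFun := fun A => A.1 0
        map_add' := fun _ _ => rfl
        map_smul' := fun _ _ => rfl }
    have hker : LinearMap.ker ev = ⊥ := by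
      rw [LinearMap.ker_eq_bot']
      exact fun A hA => Subtype.ext (hev A.1 A.2 hA)
    exact b.linearIndependent.map' ev hker
  have hli : ∀ᶠ x in 𝓝 (0 : Fin 3 → ℝ), LinearIndependent ℝ fun i => (b i).1 x := by
    have hc : Continuous fun x (i : Fin 2) => (b i).1 x :=
      continuous_pi fun i => AffineMap.continuous_of_finiteDimensional _
    exact hc.continuousAt.eventually (isOpen_setOfPred_linearIndependent.mem_nhds hli0)
  have htan : ∀ᶠ x in 𝓝 (0 : Fin 3 → ℝ), ∀ i, ρ x = 0 → fderiv ℝ ρ x ((b i).1 x) = 0 :=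
    eventually_all.2 fun i => (b i).2
  have hgood := hρ.eventually_analyticAt.and
    ((hρ.fderiv.continuousAt.eventually_ne hρ0).and (htan.and hli))
  obtain ⟨Ψ, h0, hΨ, -⟩ := exists_straightening hρ hρ0
  have hsymm : Tendsto Ψ.symm (𝓝 (Ψ 0)) (𝓝 0) := by
    have := Ψ.symm.continuousAt (Ψ.map_source h0)
    rwa [ContinuousAt, Ψ.left_inv h0] at this
  obtain ⟨δ, hδ, hball⟩ := Metric.eventually_nhds_iff_ball.1
    ((Ψ.open_target.eventually_mem (Ψ.map_source h0)).and (hsymm.eventually hgood))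
  -- This makes the zero set in `O` the homeomorphic image of a ball cut by a hyperplane, hence
  -- connected.
  set O := Ψ.source ∩ Ψ ⁻¹' Metric.ball (Ψ 0) δ with hO
  have hOo : IsOpen O := Ψ.isOpen_inter_preimage Metric.isOpen_ball
  have h0O : (0 : Fin 3 → ℝ) ∈ O := ⟨h0, Metric.mem_ball_self hδ⟩
  have hg : ∀ x ∈ O, AnalyticAt ℝ ρ x ∧ fderiv ℝ ρ x ≠ 0 ∧
      (∀ i, ρ x = 0 → fderiv ℝ ρ x ((b i).1 x) = 0) ∧
      LinearIndependent ℝ fun i => (b i).1 x := by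
    intro x hx
    have := (hball _ hx.2).2
    rwa [Ψ.left_inv hx.1] at this
  set S := {x ∈ O | ρ x = 0} with hS
  have hdef : ∀ x ∈ S, IsLocalDefiningFunction S x ρ := by
    intro x hx
    refine ⟨(hg x hx.1).1, (hg x hx.1).2.1, ?_⟩
    filter_upwards [hOo.mem_nhds hx.1] with y hy
    exact ⟨fun h => h.2, fun h => ⟨hy, h⟩⟩
  -- A field tangent near the origin is a combination of the two basis fields, and `O` was chosen so
  -- that these are tangent along all of `S`.
  have haff : affSymmetries S = affSymmetriesNear ρ := by
    refine le_antisymm (fun A hA => ?_) fun A hA => ?_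
    · change ∀ᶠ x in 𝓝 0, ρ x = 0 → fderiv ℝ ρ x (A x) = 0
      filter_upwards [hOo.mem_nhds h0O] with x hx hρx
      exact ((hdef x ⟨hx, hρx⟩).mem_tangentSpaceAt_iff ⟨hx, hρx⟩).1 (hA x ⟨hx, hρx⟩)
    · have hb : ∀ i, (b i).1 ∈ affSymmetries S := fun i x hx =>
        ((hdef x hx).mem_tangentSpaceAt_iff hx).2 ((hg x hx.1).2.2.1 i hx.2)
      have hsum := congrArg Subtype.val (b.sum_repr ⟨A, hA⟩)
      rw [← show _ = A from hsum, Submodule.coe_sum]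
      exact Submodule.sum_mem _ fun i _ => Submodule.smul_mem _ _ (hb i)
  refine ⟨O, hOo, h0O, ?_, fun x hx => ⟨ρ, hdef x hx⟩, fun x hx v hv => ?_, haff ▸ hdim⟩
  · have himage : S = Ψ.symm '' (Metric.ball (Ψ 0) δ ∩ {y | fderiv ℝ ρ 0 y = 0}) := by
      ext x
      constructor
      · rintro ⟨⟨hx1, hx2⟩, hx3⟩
        exact ⟨Ψ x, ⟨hx2, (hΨ x).trans hx3⟩, Ψ.left_inv hx1⟩
      · rintro ⟨y, ⟨hy1, hy2⟩, rfl⟩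
        have hyt := (hball y hy1).1
        refine ⟨⟨Ψ.map_target hyt, ?_⟩, ?_⟩
        · change Ψ (Ψ.symm y) ∈ Metric.ball (Ψ 0) δ
          rwa [Ψ.right_inv hyt]
        · rw [← hΨ, Ψ.right_inv hyt]
          exact hy2
    refine ⟨⟨0, h0O, hρz⟩, ?_⟩
    change IsPreconnected S
    rw [himage]
    refine IsPreconnected.image (Convex.isPreconnected ?_) _
      (Ψ.continuousOn_symm.mono fun y hy => (hball y hy.1).1)
    exact (convex_ball _ _).inter
      (LinearMap.ker (fderiv ℝ ρ 0 : (Fin 3 → ℝ) →ₗ[ℝ] ℝ)).convex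
  · have hrank : Module.finrank ℝ (tangentSpaceAt S x) = 2 := by
      have := finrank_tangentSpaceAt (hdef x hx) hx
      simp at this
      omega
    obtain ⟨c, hc⟩ := Submodule.exists_sum_eq_of_linearIndependent (tangentSpaceAt S x) hrank
      two_pos (hg x hx.1).2.2.2
      (fun i => ((hdef x hx).mem_tangentSpaceAt_iff hx).2 ((hg x hx.1).2.2.1 i hx.2)) hv
    refine ⟨(∑ i, c i • b i : affSymmetriesNear ρ).1, haff.symm.le (∑ i, c i • b i).2, ?_⟩
    rw [← hc]
    simp [Fin.sum_univ_two]

open HolVectorField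

theorem IsTubeChart.isLocallyBiholomorphicAt {M : Set (Fin 3 → ℂ)} {p : Fin 3 → ℂ}
    {f : Fin 3 → HolVectorField p} {Φ : OpenPartialHomeomorph (Fin 3 → ℂ) (Fin 3 → ℂ)}
    {ρ : (Fin 3 → ℝ) → ℝ} (hT : IsTubeChart M p f Φ ρ) {O : Set (Fin 3 → ℝ)} (hO : IsOpen O)
    (h0 : 0 ∈ O) : IsLocallyBiholomorphicAt M (tubeOver {x ∈ O | ρ x = 0}) p := by
  obtain ⟨U, hU, hUo, hpU⟩ := eventually_nhds_iff.1
    (hT.mem_iff.and (hT.tendsto_rePart.eventually (hO.eventually_mem h0)))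
  let φ := Φ.restrOpen U hUo
  have hsrc : φ.source = Φ.source ∩ U := Φ.restrOpen_source U hUo
  have hsub : φ.target ⊆ Φ.target := fun z hz => hz.1
  refine ⟨φ, hsrc ▸ ⟨hT.mem_source, hpU⟩, fun q hq => ?_, fun z hz => ?_, ?_⟩
  · exact (hT.analyticAt q (hsrc ▸ hq).1).differentiableAt.differentiableWithinAt
  · exact (hT.analyticAt_symm z (hsub hz)).differentiableAt.differentiableWithinAt
  have hmem : ∀ q ∈ φ.source, (q ∈ M ↔ φ q ∈ tubeOver {x ∈ O | ρ x = 0}) := by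
    intro q hq
    obtain ⟨h1, h2⟩ := hU q (hsrc ▸ hq).2
    exact h1.trans ⟨fun h => ⟨h2, h⟩, fun h => h.2⟩
  ext z
  constructor
  · rintro ⟨q, ⟨hqM, hq⟩, rfl⟩
    exact ⟨(hmem q hq).1 hqM, φ.map_source hq⟩
  · rintro ⟨hzS, hz⟩
    refine ⟨φ.symm z, ⟨(hmem _ (φ.map_target hz)).2 ?_, φ.map_target hz⟩, φ.right_inv hz⟩
    rwa [φ.right_inv hz]

end AffineSurface

/-! ### Assembly -/

theorem corollary5p3 (M : Set (Fin 3 → ℂ)) (hM : IsAnalyticHypersurface M)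
    (hst : IsHolSimplyTransitive M) (hLevi : ∀ q ∈ M, IsLeviNondegenerateAt M q)
    (p : Fin 3 → ℂ) (hp : p ∈ M)
    (hideal : ∃ 𝔞 : LieIdeal ℝ (hol M p), IsLieAbelian 𝔞 ∧ Module.finrank ℝ 𝔞 = 3) :
    ∃ S : Set (Fin 3 → ℝ), IsConnected S ∧ IsAnalyticHypersurface S ∧ IsAffSimplyTransitive S ∧
      IsLocallyBiholomorphicAt M (tubeOver S) p := by
  obtain ⟨𝔞, habel, hdim⟩ := hideal
  obtain ⟨r, hr, hL⟩ := hLevi p hp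
  -- The ideal is moved into the space of all holomorphic germs, where complex combinations of
  -- symmetries make sense.
  obtain ⟨A, hA, hid, hab, hdimA⟩ : ∃ A : Submodule ℝ (HolVectorField p),
      (∀ g ∈ A, g ∈ hol M p) ∧ (∀ g ∈ hol M p, ∀ h ∈ A, ⁅g, h⁆ ∈ A) ∧
      (∀ g ∈ A, ∀ h ∈ A, ⁅g, h⁆ = 0) ∧ Module.finrank ℝ A = 3 := by
    refine ⟨𝔞.toSubmodule.map (hol M p).toSubmodule.subtype, ?_, ?_, ?_, ?_⟩
    · rintro _ ⟨g, -, rfl⟩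
      exact g.2
    · rintro g hg _ ⟨h, hh, rfl⟩
      exact ⟨⁅(⟨g, hg⟩ : hol M p), h⁆, lie_mem_right ℝ _ 𝔞 _ _ hh, rfl⟩
    · rintro _ ⟨g, hg, rfl⟩ _ ⟨h, hh, rfl⟩
      have := habel.trivial ⟨g, hg⟩ ⟨h, hh⟩
      exact congrArg (fun x : 𝔞 => (x.1 : HolVectorField p)) this
    · exact (Submodule.equivMapOfInjective _ Subtype.val_injective _).finrank_eq.symm.trans hdim
  have hfin : Module.Finite ℝ A := Module.finite_of_finrank_pos (by omega)
  let b := Module.finBasisOfFinrankEq ℝ A hdimA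
  let f : Fin 3 → HolVectorField p := fun j => (b j).1
  have hfA : ∀ j, f j ∈ A := fun j => (b j).2
  have hli : LinearIndependent ℂ fun j => HolVectorField.val (f j) :=
    linearIndependent_val hfA (b.linearIndependent.map' A.subtype A.ker_subtype)
      (fun g hg => eq_zero_of_val_eq_zero hst hr hp (hA g hg))
      fun U hU V hV => val_eq_zero_of_null hst hp hr hL hA hid hab hdimA hU hV
  obtain ⟨Φ, ρ, hT⟩ := exists_isTubeChart hr hp (fun j => hA _ (hfA j))
    (fun i j => hab _ (hfA i) _ (hfA j)) hli
  have haff : ∀ g ∈ hol M p, ∃ a, hT.affineField a = g := by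
    intro g hg
    have hmem : ∀ k, ⁅f k, g⁆ ∈ A := fun k => by
      rw [← lie_skew]
      exact A.neg_mem (hid g hg _ (hfA k))
    refine hT.exists_affineField_eq hli (c := fun k j => b.repr ⟨_, hmem k⟩ j) fun k => ?_
    have hsum := congrArg Subtype.val (b.sum_repr ⟨_, hmem k⟩)
    rw [Submodule.coe_sum] at hsum
    exact hsum.symm
  have hρz : ρ 0 = 0 := by
    have := hT.mem_iff.self_of_nhds.1 hp
    rwa [hT.map_base, map_zero] at this
  obtain ⟨O, hO, h0, hS1, hS2, hS3⟩ := exists_isAffSimplyTransitive hT.analyticAt_base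
    hT.fderiv_base hρz (hT.finrank_affSymmetriesNear hst hp haff)
    fun A hA => hT.eq_zero_of_mem_affSymmetriesNear hst hp hA
  exact ⟨_, hS1, hS2, hS3, hT.isLocallyBiholomorphicAt hO h0⟩
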